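/- Let $d\ge 1$ and let $(D_n)$ be subsets of $\mathbb Z^d$ satisfying the following geometric assumption: $D_n=C_n\cap\mathbb Z^d$, where for a fixed $p$ every $C_n\subseteq\mathbb R^d$ is a union of $p$ convex bodies (compact convex sets with non-empty interior), $|C_n|\to\infty$ ($|\cdot|$ is Lebesgue measure, and cardinality for subsets of $\mathbb Z^d$), and there are vectors $\mathbf c_n=(c_{n,1},\dots,c_{n,d})$ with positive entries such that $c_{n,\ell}\to\infty$ for each $\ell$, $c_{n,1}\cdots c_{n,d}\sim|C_n|$, and $C_n\subseteq\prod_{\ell}[-c\,c_{n,\ell},c\,c_{n,\ell}]$ for all $n$ and some $0<c<\infty$. Let $K_n=\mathbb Z^d\cap\prod_\ell[-\kappa c_{n,\ell},\kappa c_{n,\ell}]$, where $\kappa>0$ is such that $D_n\subseteq K_n$ for all large $n$. Let $(\xi_v)_{v\in\mathbb Z^d}$ be a (strictly) stationary real random field, write $M_\xi(A)=\max_{v\in A}\xi_v$ (with $M_\xi(\emptyset)=-\infty$), and let $(x_n)$ be a real sequence. Assume the mixing condition $\mathcal D(x_n;K_n)$, with sequences $(\boldsymbol\gamma_n)$ and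 $(\alpha_n)$: the vectors $\boldsymbol\gamma_n=(\gamma_{n,1},\dots,\gamma_{n,d})\in\mathbb R^d$ are (weakly, entrywise) increasing in $n$, $\gamma_{n,\ell}/c_{n,\ell}\to0$ for each $\ell$, $\alpha_n\to0$, and for all $n$ and all $A,B\subseteq K_n$ that are $\boldsymbol\gamma_n$-separated and at least one of which is a box (a product of integer intervals), $$\bigl|\mathbb P(M_\xi(A\cup B)\le x_n)-\mathbb P(M_\xi(A)\le x_n)\,\mathbb P(M_\xi(B)\le x_n)\bigr|\le\alpha_n .$$ Here $A,B$ are $\boldsymbol\gamma$-separated if no $b\in B$ is of the form $a+(\gamma_1u_1,\dots,\gamma_du_d)$ with $a\in A$ and $u\in\mathbb R^d$, $u_1^2+\dots+u_d^2\le1$. Let $(k_n)$ be a sequence of positive integers with $k_n\to\infty$, $k_n\alpha_n\to0$ and $k_n^{1/d}\gamma_{n,\ell}/c_{n,\ell}\to0$ for each $\ell$. Put $t_{n,k_n}^\ell=\lfloor c_{n,\ell}/k_n^{1/d}\rfloor$, let $\preceq$ be any translation invariant total order on $\mathbb Z^d$ with strict part $\prec$, and let $$A_0^{n,k_n}=\bigl\{z\in\mathbb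 Z^d:\ |z_\ell|\le t_{n,k_n}^\ell\text{ for all }\ell,\ 0\prec z\bigr\}.$$ Then, as $n\to\infty$, $$\mathbb P(M_\xi(D_n)\le x_n)\le\exp\Bigl(-|D_n|\,\mathbb P\bigl(M_\xi(A_0^{n,k_n})\le x_n<\xi_0\bigr)\Bigr)+o(1).$$ If in addition $\limsup_{n\to\infty}|D_n|\,\mathbb P(\xi_0>x_n)<\infty$, then $$\mathbb P(M_\xi(D_n)\le x_n)=\exp\Bigl(-|D_n|\,\mathbb P\bigl(M_\xi(A_0^{n,k_n})\le x_n<\xi_0\bigr)\Bigr)+o(1).$$ -/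

import Mathlib

open MeasureTheory ProbabilityTheory Filter Topology Asymptotics
open scoped ENNReal

namespace SpatialMax

/-- A convex body in `ℝ^d`: a compact convex set with non-empty interior. -/
structure IsBody {d : ℕ} (S : Set (Fin d → ℝ)) : Prop where
  compact : IsCompact S
  convex : Convex ℝ S
  interior_nonempty : (interior S).Nonempty

/-- A `p`-convex set: a union of `p` convex bodies. -/
def IsPConvex {d : ℕ} (p : ℕ) (S : Set (Fin d → ℝ)) : Prop :=
  ∃ T : Fin p → Set (Fin d → ℝ), (∀ i, IsBody (T i)) ∧ S = ⋃ i, T i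

/-- The lattice points `S ∩ ℤ^d` of a set `S ⊆ ℝ^d`. -/
def latticePoints {d : ℕ} (S : Set (Fin d → ℝ)) : Set (Fin d → ℤ) :=
  {v | (fun l => (v l : ℝ)) ∈ S}

/-- The box `𝐜 [-κ, κ]^d` for a vector `𝐜` with positive entries. -/
def scaledBox {d : ℕ} (κ : ℝ) (c : Fin d → ℝ) : Set (Fin d → ℝ) :=
  {y | ∀ l, |y l| ≤ κ * c l}

/-- The geometric assumption on the index sets `D n ⊆ ℤ^d`, with scaling vectors `c n`. -/
def GeometricAssumption {d : ℕ} (D : ℕ → Set (Fin d → ℤ)) (c : ℕ → Fin d → ℝ) : Prop :=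
  ∃ (p : ℕ) (C : ℕ → Set (Fin d → ℝ)),
    (∀ n, IsPConvex p (C n)) ∧
    (∀ n, D n = latticePoints (C n)) ∧
    Tendsto (fun n => volume.real (C n)) atTop atTop ∧
    (∀ n l, 0 < c n l) ∧
    (∀ l, Tendsto (fun n => c n l) atTop atTop) ∧
    (fun n => ∏ l, c n l) ~[atTop] (fun n => volume.real (C n)) ∧
    ∃ κ : ℝ, 0 < κ ∧ ∀ n, C n ⊆ scaledBox κ (c n)

/-- The surrounding lattice box `K_n = ℤ^d ∩ 𝐜_n [-κ, κ]^d`. -/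
def surroundingBox {d : ℕ} (κ : ℝ) (c : Fin d → ℝ) : Set (Fin d → ℤ) :=
  latticePoints (scaledBox κ c)

/-- `A, B ⊆ ℤ^d` are `γ`-separated: no point of `B` lies in `A ⊕ γ B(1)`, where
`γ B(1) = {(γ_1 u_1, …, γ_d u_d) : u_1² + ⋯ + u_d² ≤ 1}`. -/
def Separated {d : ℕ} (γ : Fin d → ℝ) (A B : Set (Fin d → ℤ)) : Prop :=
  ∀ b ∈ B, ¬ ∃ a ∈ A, ∃ u : Fin d → ℝ, ∑ l, u l ^ 2 ≤ 1 ∧ ∀ l, (b l : ℝ) = a l + γ l * u l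

/-- A box in `ℤ^d`: a product of integer intervals. -/
def IsBox {d : ℕ} (A : Set (Fin d → ℤ)) : Prop :=
  ∃ a b : Fin d → ℤ, A = Set.Icc a b

/-- The maximum `M_ξ(A)` of the field over `A`, with value `-∞` for `A = ∅`. -/
noncomputable def fieldMax {d : ℕ} {Ω : Type*} (ξ : (Fin d → ℤ) → Ω → ℝ)
    (A : Set (Fin d → ℤ)) (ω : Ω) : EReal :=
  ⨆ v ∈ A, (ξ v ω : EReal)

/-- A (strictly) stationary real random field on `ℤ^d`: all its translates have the same law. -/
structure IsStationaryField {d : ℕ} {Ω : Type*} [MeasurableSpace Ω] (P : Measure Ω)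
    (ξ : (Fin d → ℤ) → Ω → ℝ) : Prop where
  measurable : ∀ v, Measurable (ξ v)
  stationary : ∀ h : Fin d → ℤ,
    P.map (fun ω v => ξ (v + h) ω) = P.map (fun ω v => ξ v ω)

/-- The mixing condition `𝒟(x_n; K_n)`, witnessed by the sequences `γ` and `α`. -/
structure MixingCondition {d : ℕ} {Ω : Type*} [MeasurableSpace Ω] (P : Measure Ω)
    (ξ : (Fin d → ℤ) → Ω → ℝ) (x : ℕ → ℝ) (K : ℕ → Set (Fin d → ℤ))
    (c : ℕ → Fin d → ℝ) (γ : ℕ → Fin d → ℝ) (α : ℕ → ℝ) : Prop where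
  mono : Monotone γ
  gamma_small : ∀ l, Tendsto (fun n => γ n l / c n l) atTop (𝓝 0)
  alpha_small : Tendsto α atTop (𝓝 0)
  mixing : ∀ n, ∀ A B : Set (Fin d → ℤ), A ⊆ K n → B ⊆ K n → Separated (γ n) A B →
    (IsBox A ∨ IsBox B) →
    |P.real {ω | fieldMax ξ (A ∪ B) ω ≤ (x n : EReal)} -
      P.real {ω | fieldMax ξ A ω ≤ (x n : EReal)} *
        P.real {ω | fieldMax ξ B ω ≤ (x n : EReal)}| ≤ α n

/-- A translation invariant total order on `ℤ^d`. -/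
structure IsInvariantTotalOrder {d : ℕ} (le : (Fin d → ℤ) → (Fin d → ℤ) → Prop) : Prop where
  refl : ∀ u, le u u
  trans : ∀ u v w, le u v → le v w → le u w
  antisymm : ∀ u v, le u v → le v u → u = v
  total : ∀ u v, le u v ∨ le v u
  add_right : ∀ u v w, le u v → le (u + w) (v + w)

/-- The side lengths `t_ℓ = ⌊c_ℓ / k^{1/d}⌋`. -/
noncomputable def sideLength {d : ℕ} (c : Fin d → ℝ) (k : ℕ) (l : Fin d) : ℤ :=
  ⌊c l / (k : ℝ) ^ (1 / (d : ℝ))⌋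

/-- `A_v = {z ∈ (v + 𝐭 [-1, 1]^d) ∩ ℤ^d : v ≺ z}`, with `v ≺ z` meaning `v ⪯ z` and `v ≠ z`. -/
def laterPoints {d : ℕ} (le : (Fin d → ℤ) → (Fin d → ℤ) → Prop) (t : Fin d → ℤ)
    (v : Fin d → ℤ) : Set (Fin d → ℤ) :=
  {z | (∀ l, |z l - v l| ≤ t l) ∧ le v z ∧ v ≠ z}

end SpatialMax

/-!
The index set `D_n` is tiled by lattice cells with side lengths `t + 1`, where `t = t_{n,k_n}`. From
each cell contained in `D_n` one keeps a block with side lengths `s = t + 1 - ⌊|γ_n|⌋`, so that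
different blocks are `γ_n`-separated (`exists_gap_of_mem_block`, `separated_of_gap`).

*Geometry.* A closed convex set in the box `𝐜 [-κ, κ]^d` has few boundary cells: for a boundary cell
take a functional separating the set from a point of the cell, and a coordinate `l` in which it
dominates. In a column of cells in direction `l` at most `d` cells are of the same type, so the
number of boundary cells is of the order of a face of the box (`ncard_boundaryCells_le`). Hence, for
a negligible mesh, the cells inside `D_n` fill `D_n` up to a negligible proportion; for mesh `1`
this also compares `|D_n|` with the volume of `C_n` (`GeometricAssumption.asymptotics`). There are
`m = O(k_n)` blocks (`tiling_asymptotics`).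

*Upper bound.* Mixing, applied `m` times, replaces the probability of no exceedance in the blocks by
`P(M(B) ≤ x)^m`, with an error `m α_n → 0`. Inside one block the events `M(A_v) ≤ x < ξ_v` are
disjoint, so `P(M(B) > x) ≥ |B| q` with `q = P(M(A_0) ≤ x < ξ_0)`
(`IsStationaryField.measureReal_underLevel_le`). Finally `m |B| / |D_n| → 1` and `exp (- r y)` is
close to `exp (- y)` uniformly in `y ≥ 0` as `r → 1` (`exp_neg_mul_le`).

*Lower bound.* If a block contains an exceedance, consider the last one. Either `M(A_v) ≤ x < ξ_v`
holds there, or there is an exceedance in the gap of width `|γ_n|` around the block, or there is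
another one at a `γ_n`-separated place within distance `t`. The gap has few points, and the last
probability factorizes by mixing up to `α_n`, for each block and not for each point, so the
errors sum to `o(1)` when `|D_n| P(ξ_0 > x_n)` is bounded
(`IsStationaryField.measureReal_compl_block_le`, `error_le`). By stationarity this is done for a
block at the origin, whose neighbourhood lies in `K_n`.
-/

namespace SpatialMax

/-! ### Lattice cells meeting the boundary of a convex set -/

/-- The closed cell with index `i` of the grid in `ℝ^d` with mesh `τ`. -/
def cell {d : ℕ} (τ i : Fin d → ℤ) : Set (Fin d → ℝ) :=
  {y | ∀ l, (τ l * i l : ℝ) ≤ y l ∧ y l ≤ τ l * (i l + 1)}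

/-- The indices of the grid cells that meet `S` without being contained in `S`. -/
def boundaryCells {d : ℕ} (τ : Fin d → ℤ) (S : Set (Fin d → ℝ)) : Set (Fin d → ℤ) :=
  {i | (cell τ i ∩ S).Nonempty ∧ ¬ cell τ i ⊆ S}

/-- The functional separating a closed convex set from a point of a boundary cell has a dominating
coordinate `l`; walking from the cell in direction `l`, on the side `σ` to which the functional
grows, one leaves the set after fewer than `d` cells. -/
lemma exists_direction_of_mem_boundaryCells {d : ℕ} (hd : 1 ≤ d) {τ : Fin d → ℤ}
    (hτ : ∀ l, 0 < τ l) {S : Set (Fin d → ℝ)} (hc : IsClosed S) (hconv : Convex ℝ S)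
    {i : Fin d → ℤ} (hi : i ∈ boundaryCells τ S) :
    ∃ (l : Fin d) (σ : ℤ), (σ = 1 ∨ σ = -1) ∧ ∀ i', (cell τ i' ∩ S).Nonempty →
      (∀ j, j ≠ l → i' j = i j) → σ * (i' l - i l) < d := by
  obtain ⟨-, h2⟩ := hi
  obtain ⟨y, hy, hyS⟩ := Set.not_subset.1 h2
  obtain ⟨f, u, hfS, hfy⟩ := geometric_hahn_banach_closed_point hconv hc hyS
  set e : Fin d → ℝ := fun j => f (Pi.single j 1) with he
  have hf : ∀ z, f z = ∑ j, z j * e j := by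
    intro z
    have := LinearMap.pi_apply_eq_sum_univ (f : (Fin d → ℝ) →ₗ[ℝ] ℝ) z
    simp only [smul_eq_mul, ContinuousLinearMap.coe_coe] at this
    rw [this]
    refine Finset.sum_congr rfl fun j _ => ?_
    congr 2
    funext x
    simp [Pi.single_apply, eq_comm]
  have : Nonempty (Fin d) := ⟨⟨0, hd⟩⟩
  obtain ⟨l, hl⟩ := Finite.exists_max (fun j => |e j| * (τ j : ℝ))
  have hτ' : ∀ j, (0 : ℝ) < τ j := fun j => by exact_mod_cast hτ j
  obtain ⟨σ, hσ, hσe⟩ : ∃ σ : ℤ, (σ = 1 ∨ σ = -1) ∧ e l = σ * |e l| := by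
    rcases le_total 0 (e l) with h | h
    · exact ⟨1, Or.inl rfl, by simp [abs_of_nonneg h]⟩
    · exact ⟨-1, Or.inr rfl, by simp [abs_of_nonpos h]⟩
  refine ⟨l, σ, hσ, ?_⟩
  rintro i' ⟨z, hz, hzS⟩ hi'
  by_contra! hge
  have hlt : ∑ j, (z j - y j) * e j < 0 := by
    have := (hfS z hzS).trans hfy
    rw [hf z, hf y] at this
    simp only [sub_mul, Finset.sum_sub_distrib]
    linarith
  have hrest : ∀ j ∈ Finset.univ.erase l, -(|e l| * τ l) ≤ (z j - y j) * e j := by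
    intro j hj
    have hjl : j ≠ l := Finset.ne_of_mem_erase hj
    have h1 := hz j
    have h2 := hy j
    rw [hi' j hjl] at h1
    have h3 : |z j - y j| ≤ τ j := by
      rw [abs_le]; constructor <;> nlinarith [h1.1, h1.2, h2.1, h2.2]
    have h4 : |(z j - y j) * e j| ≤ |e j| * τ j := by
      rw [abs_mul, mul_comm]; exact mul_le_mul_of_nonneg_left h3 (abs_nonneg _)
    have := hl j
    linarith [neg_abs_le ((z j - y j) * e j)]
  have hmain : ((d : ℝ) - 1) * (|e l| * τ l) ≤ (z l - y l) * e l := by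
    have hge' : (d : ℝ) ≤ σ * ((i' l : ℝ) - i l) := by exact_mod_cast hge
    have h1 := hz l
    have h2 := hy l
    have h3 : ((d : ℝ) - 1) * τ l ≤ σ * (z l - y l) := by
      rcases hσ with rfl | rfl <;> push_cast at hge' ⊢ <;>
        nlinarith [h1.1, h1.2, h2.1, h2.2, hτ' l]
    have h4 := mul_le_mul_of_nonneg_right h3 (abs_nonneg (e l))
    rw [hσe, abs_mul, abs_abs]
    have : |(σ : ℝ)| = 1 := by rcases hσ with rfl | rfl <;> simp
    rw [this]
    linarith
  have hsum := Finset.sum_le_sum hrest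
  rw [← Finset.add_sum_erase _ _ (Finset.mem_univ l)] at hlt
  simp only [Finset.sum_const, Finset.card_erase_of_mem (Finset.mem_univ l), Finset.card_univ,
    Fintype.card_fin, nsmul_eq_mul] at hsum
  rw [Nat.cast_sub hd] at hsum
  push_cast at hsum
  linarith

/-- The range of indices of the grid cells that can meet the box `𝐜 [-κ, κ]^d`. -/
noncomputable def indexRange (κ c : ℝ) (τ : ℤ) : Finset ℤ :=
  Finset.Icc ⌈-(κ * c / τ) - 1⌉ ⌊κ * c / τ⌋

lemma card_indexRange_le {κ c : ℝ} {τ : ℤ} (h : 0 ≤ κ * c / τ) :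
    ((indexRange κ c τ).card : ℝ) ≤ 2 * (κ * c / τ) + 2 := by
  rw [indexRange, Int.card_Icc]
  set β := κ * c / τ
  have h1 : (⌊β⌋ : ℝ) ≤ β := Int.floor_le _
  have h2 : -β - 1 ≤ (⌈-β - 1⌉ : ℝ) := Int.le_ceil _
  rcases le_total 0 (⌊β⌋ + 1 - ⌈-β - 1⌉) with h0 | h0
  · have : (((⌊β⌋ + 1 - ⌈-β - 1⌉).toNat : ℤ) : ℝ) = ((⌊β⌋ + 1 - ⌈-β - 1⌉ : ℤ) : ℝ) := by
      rw [Int.toNat_of_nonneg h0]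
    rw [Int.cast_natCast] at this
    rw [this]; push_cast; linarith
  · rw [Int.toNat_of_nonpos h0]; push_cast; linarith

lemma mem_indexRange {d : ℕ} {κ : ℝ} {c : Fin d → ℝ} {τ i : Fin d → ℤ} (hτ : ∀ l, 0 < τ l)
    (hi : (cell τ i ∩ scaledBox κ c).Nonempty) (l : Fin d) : i l ∈ indexRange κ (c l) (τ l) := by
  obtain ⟨y, hy, hyc⟩ := hi
  have hτ' : (0 : ℝ) < τ l := by exact_mod_cast hτ l
  have h := abs_le.1 (hyc l)
  rw [indexRange, Finset.mem_Icc, Int.ceil_le, Int.le_floor]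
  constructor
  · have : -(i l : ℝ) - 1 ≤ κ * c l / τ l := by
      rw [le_div_iff₀ hτ']; nlinarith [(hy l).2]
    linarith
  · rw [le_div_iff₀ hτ']; nlinarith [(hy l).1]

lemma finite_boundaryCells {d : ℕ} {κ : ℝ} {c : Fin d → ℝ} {τ : Fin d → ℤ}
    (hτ : ∀ l, 0 < τ l) {S : Set (Fin d → ℝ)} (hS : S ⊆ scaledBox κ c) :
    (boundaryCells τ S).Finite := by
  refine (Fintype.piFinset fun l => indexRange κ (c l) (τ l)).finite_toSet.subset ?_
  intro i hi
  simp only [Finset.mem_coe, Fintype.mem_piFinset]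
  exact mem_indexRange hτ (hi.1.mono (Set.inter_subset_inter_right _ hS))

/-- A closed convex set inside a box has few boundary cells: at most `d` of each of the `2 d`
types `(l, σ)` in every column of cells in direction `l`. -/
lemma ncard_boundaryCells_le {d : ℕ} (hd : 1 ≤ d) {κ : ℝ} {c : Fin d → ℝ} {τ : Fin d → ℤ}
    (hκ : 0 < κ) (hcpos : ∀ l, 0 < c l)
    (hτ : ∀ l, 0 < τ l) {S : Set (Fin d → ℝ)} (hc : IsClosed S) (hconv : Convex ℝ S)
    (hS : S ⊆ scaledBox κ c) :
    ((boundaryCells τ S).ncard : ℝ) ≤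
      ∑ l, 2 * ∏ j, (if j = l then (d : ℝ) else 2 * (κ * c j / τ j) + 2) := by
  classical
  let W : Fin d → ℤ → Set (Fin d → ℤ) := fun l σ =>
    {i | i ∈ boundaryCells τ S ∧ ∀ i' ∈ boundaryCells τ S,
      (∀ j, j ≠ l → i' j = i j) → σ * (i' l - i l) < d}
  have hfin : ∀ l σ, (W l σ).Finite := fun l σ =>
    (finite_boundaryCells hτ hS).subset fun i hi => hi.1
  have hcover : boundaryCells τ S ⊆ ⋃ l ∈ (Finset.univ : Finset (Fin d)), (W l 1 ∪ W l (-1)) := by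
    intro i hi
    obtain ⟨l, σ, hσ, h⟩ := exists_direction_of_mem_boundaryCells hd hτ hc hconv hi
    simp only [Finset.mem_univ, Set.iUnion_true, Set.mem_iUnion]
    refine ⟨l, ?_⟩
    rcases hσ with rfl | rfl
    · exact Or.inl ⟨hi, fun i' hi' => h i' hi'.1⟩
    · exact Or.inr ⟨hi, fun i' hi' => h i' hi'.1⟩
  have hW : ∀ l σ, (σ = 1 ∨ σ = -1) → ((W l σ).ncard : ℝ) ≤
      ∏ j, (if j = l then (d : ℝ) else 2 * (κ * c j / τ j) + 2) := by
    intro l σ hσ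
    let F : Finset (Fin d → ℤ) := Fintype.piFinset fun j =>
      if j = l then Finset.Ico 0 (d : ℤ) else indexRange κ (c j) (τ j)
    have hd0 : (0 : ℤ) < d := by exact_mod_cast hd
    have h1 : (W l σ).ncard ≤ (F : Set (Fin d → ℤ)).ncard := by
      -- Reducing the `l`-th index modulo `d` is injective on each type.
      refine Set.ncard_le_ncard_of_injOn (fun i => Function.update i l (i l % d)) ?_ ?_
        F.finite_toSet
      · intro i hi
        simp only [F, Finset.mem_coe, Fintype.mem_piFinset]
        intro j
        by_cases hj : j = l
        · subst hj
          simp [Int.emod_nonneg _ hd0.ne', Int.emod_lt_of_pos _ hd0]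
        · simpa [hj] using mem_indexRange hτ
            (hi.1.1.mono (Set.inter_subset_inter_right _ hS)) j
      · intro i hi i' hi' heq
        have hcol : ∀ j, j ≠ l → i j = i' j := by
          intro j hj
          simpa [hj] using congrFun heq j
        have hmod : i l % d = i' l % d := by simpa using congrFun heq l
        have ha := hi.2 i' hi'.1 (fun j hj => (hcol j hj).symm)
        have hb := hi'.2 i hi.1 hcol
        have habs : |i l - i' l| < d := by
          rw [abs_lt]; rcases hσ with rfl | rfl <;> constructor <;> linarith
        have hdvd : (d : ℤ) ∣ i l - i' l :=
          Int.ModEq.dvd (show i' l ≡ i l [ZMOD d] from hmod.symm)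
        have hz := Int.eq_zero_of_abs_lt_dvd hdvd habs
        funext j
        by_cases hj : j = l
        · subst hj; linarith
        · exact hcol j hj
    rw [Set.ncard_coe_finset] at h1
    refine (Nat.cast_le.2 h1).trans ?_
    rw [Fintype.card_piFinset, Nat.cast_prod]
    refine Finset.prod_le_prod (fun _ _ => by positivity) fun j _ => ?_
    by_cases hj : j = l
    · simp [hj]
    · simp only [hj, if_false]
      exact card_indexRange_le (div_nonneg (mul_pos hκ (hcpos j)).le (by exact_mod_cast (hτ j).le))
  have h2 : (boundaryCells τ S).ncard ≤ ∑ l, ((W l 1).ncard + (W l (-1)).ncard) :=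
    (Set.ncard_le_ncard hcover
      (Set.Finite.biUnion (Finset.finite_toSet _) fun l _ => (hfin l 1).union (hfin l (-1)))).trans
      ((Finset.set_ncard_biUnion_le _ _).trans
        (Finset.sum_le_sum fun l _ => Set.ncard_union_le _ _))
  refine (Nat.cast_le.2 h2).trans ?_
  push_cast
  refine Finset.sum_le_sum fun l _ => ?_
  linarith [hW l 1 (Or.inl rfl), hW l (-1) (Or.inr rfl)]


/-! ### Tiling the index sets by blocks -/

lemma boundaryCells_iUnion_subset {d p : ℕ} (τ : Fin d → ℤ) (T : Fin p → Set (Fin d → ℝ)) :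
    boundaryCells τ (⋃ a, T a) ⊆ ⋃ a ∈ (Finset.univ : Finset (Fin p)), boundaryCells τ (T a) := by
  rintro i ⟨⟨y, hy, hyT⟩, hi⟩
  obtain ⟨a, ha⟩ := Set.mem_iUnion.1 hyT
  simp only [Finset.mem_univ, Set.iUnion_true, Set.mem_iUnion]
  exact ⟨a, ⟨y, hy, ha⟩, fun h => hi (h.trans (Set.subset_iUnion _ a))⟩

lemma ncard_boundaryCells_isPConvex_le {d p : ℕ} (hd : 1 ≤ d) {κ : ℝ} {c : Fin d → ℝ}
    {τ : Fin d → ℤ} (hκ : 0 < κ) (hcpos : ∀ l, 0 < c l) (hτ : ∀ l, 0 < τ l)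
    {C : Set (Fin d → ℝ)} (hC : IsPConvex p C) (hCκ : C ⊆ scaledBox κ c) :
    ((boundaryCells τ C).ncard : ℝ) ≤
      p * ∑ l, 2 * ∏ j, (if j = l then (d : ℝ) else 2 * (κ * c j / τ j) + 2) := by
  obtain ⟨T, hT, rfl⟩ := hC
  have hTκ : ∀ a, T a ⊆ scaledBox κ c := fun a => (Set.subset_iUnion _ a).trans hCκ
  have h : (boundaryCells τ (⋃ a, T a)).ncard ≤ ∑ a, (boundaryCells τ (T a)).ncard :=
    (Set.ncard_le_ncard (boundaryCells_iUnion_subset τ T)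
      (Set.Finite.biUnion (Finset.finite_toSet _) fun a _ =>
        finite_boundaryCells hτ (hTκ a))).trans (Finset.set_ncard_biUnion_le _ _)
  refine (Nat.cast_le.2 h).trans ?_
  push_cast
  refine (Finset.sum_le_card_nsmul _ _ _ fun a _ => ncard_boundaryCells_le hd hκ hcpos hτ
    (hT a).compact.isClosed (hT a).convex (hTκ a)).trans ?_
  simp

/-- The block with side lengths `s` at the lower corner of the `i`-th cell of mesh `τ`. -/
noncomputable def block {d : ℕ} (τ s i : Fin d → ℤ) : Finset (Fin d → ℤ) :=
  Finset.Icc (fun l => τ l * i l) (fun l => τ l * i l + s l - 1)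

lemma mem_block {d : ℕ} {τ s i v : Fin d → ℤ} :
    v ∈ block τ s i ↔ ∀ l, τ l * i l ≤ v l ∧ v l ≤ τ l * i l + s l - 1 := by
  simp [block, Pi.le_def, forall_and]

lemma card_Icc_pi {d : ℕ} {a b : Fin d → ℤ} (h : ∀ l, a l ≤ b l + 1) :
    ((Finset.Icc a b).card : ℝ) = ∏ l, ((b l : ℝ) + 1 - a l) := by
  rw [Pi.card_Icc, Nat.cast_prod]
  refine Finset.prod_congr rfl fun l _ => ?_
  rw [Int.card_Icc]
  have : (((b l + 1 - a l).toNat : ℤ) : ℝ) = ((b l + 1 - a l : ℤ) : ℝ) := by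
    rw [Int.toNat_of_nonneg (by linarith [h l])]
  rw [Int.cast_natCast] at this
  rw [this]; push_cast; ring

lemma card_block {d : ℕ} {τ s i : Fin d → ℤ} (hs : ∀ l, 0 ≤ s l) :
    ((block τ s i).card : ℝ) = ∏ l, (s l : ℝ) := by
  rw [block, card_Icc_pi (fun l => by linarith [hs l])]
  refine Finset.prod_congr rfl fun l _ => ?_
  push_cast; ring

lemma exists_gap_of_mem_block {d : ℕ} {τ s i i' v w : Fin d → ℤ} (hτ : ∀ l, 0 < τ l)
    (hii : i ≠ i') (hv : v ∈ block τ s i) (hw : w ∈ block τ s i') :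
    ∃ l, τ l - s l + 1 ≤ |w l - v l| := by
  obtain ⟨l, hl⟩ := Function.ne_iff.1 hii
  refine ⟨l, ?_⟩
  have h1 := mem_block.1 hv l
  have h2 := mem_block.1 hw l
  have := hτ l
  rcases lt_or_gt_of_ne hl with h | h
  · refine le_trans ?_ (le_abs_self _)
    nlinarith
  · refine le_trans ?_ (neg_le_abs _)
    nlinarith

lemma disjoint_block {d : ℕ} {τ s i i' : Fin d → ℤ} (hτ : ∀ l, 0 < τ l) (hs : ∀ l, s l ≤ τ l)
    (hii : i ≠ i') : Disjoint (block τ s i) (block τ s i') := by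
  rw [Finset.disjoint_left]
  intro v hv hv'
  obtain ⟨l, hl⟩ := exists_gap_of_mem_block hτ hii hv hv'
  simp at hl
  linarith [hs l]

lemma mem_block_ediv {d : ℕ} {τ : Fin d → ℤ} (hτ : ∀ l, 0 < τ l) (v : Fin d → ℤ) :
    v ∈ block τ τ (fun l => v l / τ l) := by
  rw [mem_block]
  intro l
  have h1 := Int.emod_add_mul_ediv (v l) (τ l)
  have h2 := Int.emod_nonneg (v l) (hτ l).ne'
  have h3 := Int.emod_lt_of_pos (v l) (hτ l)
  constructor <;> linarith

/-- The indices of the cells of mesh `τ` all of whose lattice points lie in `D`. -/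
def innerCells {d : ℕ} (τ : Fin d → ℤ) (D : Set (Fin d → ℤ)) : Set (Fin d → ℤ) :=
  {i | (block τ τ i : Set (Fin d → ℤ)) ⊆ D}

lemma cast_mem_cell {d : ℕ} {τ i v : Fin d → ℤ} (hv : v ∈ block τ τ i) :
    (fun l => (v l : ℝ)) ∈ cell τ i := by
  intro l
  have h := mem_block.1 hv l
  have h1 : ((τ l * i l : ℤ) : ℝ) ≤ v l := by exact_mod_cast h.1
  have h2 : (v l : ℝ) ≤ ((τ l * i l + τ l : ℤ) : ℝ) := by
    exact_mod_cast (by linarith [h.2] : v l ≤ τ l * i l + τ l)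
  push_cast at h1 h2
  exact ⟨h1, by linarith⟩

lemma finite_innerCells {d : ℕ} {τ : Fin d → ℤ} (hτ : ∀ l, 0 < τ l) {D : Set (Fin d → ℤ)}
    (hD : D.Finite) : (innerCells τ D).Finite := by
  have hc : ∀ i : Fin d → ℤ, (fun l => τ l * i l) ∈ block τ τ i := fun i =>
    mem_block.2 fun l => ⟨le_rfl, by linarith [hτ l]⟩
  refine Set.Finite.of_finite_image (f := fun i l => τ l * i l) (hD.subset ?_) ?_
  · rintro _ ⟨i, hi, rfl⟩
    exact hi (hc i)
  · intro i _ i' _ h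
    funext l
    exact mul_left_cancel₀ (hτ l).ne' (congrFun h l)

lemma card_biUnion_block {d : ℕ} {τ s : Fin d → ℤ} (hτ : ∀ l, 0 < τ l) (hs0 : ∀ l, 0 ≤ s l)
    (hs : ∀ l, s l ≤ τ l) (I : Finset (Fin d → ℤ)) :
    ((I.biUnion (block τ s)).card : ℝ) = I.card * ∏ l, (s l : ℝ) := by
  rw [Finset.card_biUnion fun i _ i' _ h => disjoint_block hτ hs h, Nat.cast_sum,
    Finset.sum_congr rfl fun i _ => card_block hs0]
  simp

lemma ncard_innerCells_mul_le {d : ℕ} {τ : Fin d → ℤ} (hτ : ∀ l, 0 < τ l) {D : Set (Fin d → ℤ)}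
    (hD : D.Finite) : ((innerCells τ D).ncard : ℝ) * ∏ l, (τ l : ℝ) ≤ D.ncard := by
  have hI := finite_innerCells hτ hD
  rw [Set.ncard_eq_toFinset_card _ hI,
    ← card_biUnion_block hτ (fun l => (hτ l).le) (fun _ => le_rfl), ← Set.ncard_coe_finset,
    Nat.cast_le]
  refine Set.ncard_le_ncard ?_ hD
  intro v hv
  simp only [Finset.mem_coe, Finset.mem_biUnion, Set.Finite.mem_toFinset] at hv
  obtain ⟨i, hi, hv⟩ := hv
  exact hi hv

lemma ncard_latticePoints_le {d : ℕ} {τ : Fin d → ℤ} (hτ : ∀ l, 0 < τ l)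
    {C : Set (Fin d → ℝ)} (hfin : (latticePoints C).Finite) (hB : (boundaryCells τ C).Finite) :
    ((latticePoints C).ncard : ℝ) ≤
      ((innerCells τ (latticePoints C)).ncard + (boundaryCells τ C).ncard) *
        ∏ l, (τ l : ℝ) := by
  classical
  have hI := finite_innerCells hτ hfin
  have hsub : latticePoints C ⊆ ((hI.toFinset ∪ hB.toFinset).biUnion (block τ τ) : Finset _) := by
    intro v hv
    have hvb := mem_block_ediv hτ v
    simp only [Finset.coe_biUnion, Set.mem_iUnion, Finset.mem_coe, Finset.mem_union,
      Set.Finite.mem_toFinset]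
    refine ⟨fun l => v l / τ l, ?_, hvb⟩
    by_contra! h
    refine h.1 fun w hw => ?_
    have h2 := h.2
    simp only [boundaryCells, Set.mem_ofPred_eq, not_and, not_not] at h2
    exact h2 ⟨_, cast_mem_cell hvb, hv⟩ (cast_mem_cell hw)
  have h := Set.ncard_le_ncard hsub (Finset.finite_toSet _)
  rw [Set.ncard_coe_finset] at h
  refine (Nat.cast_le.2 h).trans ?_
  rw [card_biUnion_block hτ (fun l => (hτ l).le) (fun _ => le_rfl)]
  refine mul_le_mul_of_nonneg_right ?_
    (Finset.prod_nonneg fun l _ => by exact_mod_cast (hτ l).le)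
  rw [Set.ncard_eq_toFinset_card _ hI, Set.ncard_eq_toFinset_card _ hB]
  exact_mod_cast Finset.card_union_le _ _

lemma volume_real_cell_one {d : ℕ} (i : Fin d → ℤ) : volume.real (cell 1 i) = 1 := by
  have : cell 1 i = Set.Icc (fun l => (i l : ℝ)) (fun l => (i l : ℝ) + 1) := by
    ext y; simp [cell, Pi.le_def, forall_and]
  rw [this, measureReal_def, Real.volume_Icc_pi_toReal (fun l => by simp)]
  simp

lemma volume_real_le {d : ℕ} {C : Set (Fin d → ℝ)} (hfin : (latticePoints C).Finite)
    (hB : (boundaryCells 1 C).Finite) :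
    volume.real C ≤ (latticePoints C).ncard + (boundaryCells 1 C).ncard := by
  classical
  set J : Finset (Fin d → ℤ) := hfin.toFinset ∪ hB.toFinset
  have hsub : C ⊆ ⋃ i ∈ J, cell 1 i := by
    intro y hy
    simp only [Set.mem_iUnion, exists_prop]
    have hcell : y ∈ cell 1 (fun l => ⌊y l⌋) := fun l => by
      simpa using ⟨Int.floor_le (y l), (Int.lt_floor_add_one (y l)).le⟩
    refine ⟨fun l => ⌊y l⌋, ?_, hcell⟩
    simp only [J, Finset.mem_union, Set.Finite.mem_toFinset]
    by_contra! h
    have h2 := h.2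
    simp only [boundaryCells, Set.mem_ofPred_eq, not_and, not_not] at h2
    exact h.1 (h2 ⟨y, hcell, hy⟩ fun l => by simp)
  have hne : volume (⋃ i ∈ J, cell 1 i) ≠ ∞ := by
    refine (measure_biUnion_lt_top (Finset.finite_toSet J) fun i _ => ?_).ne
    by_contra! h
    have h1 := volume_real_cell_one i
    simp [measureReal_def, top_le_iff.1 h] at h1
  refine (measureReal_mono hsub hne).trans ((measureReal_biUnion_finset_le _ _).trans ?_)
  simp only [volume_real_cell_one, Finset.sum_const, nsmul_eq_mul, mul_one]
  rw [Set.ncard_eq_toFinset_card _ hfin, Set.ncard_eq_toFinset_card _ hB]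
  exact_mod_cast Finset.card_union_le _ _

lemma latticePoints_subset {d : ℕ} {κ : ℝ} {c : Fin d → ℝ} {C : Set (Fin d → ℝ)}
    (hC : C ⊆ scaledBox κ c) :
    latticePoints C ⊆ (Fintype.piFinset fun l => indexRange κ (c l) 1 : Finset _) := by
  intro v hv
  simp only [Finset.mem_coe, Fintype.mem_piFinset]
  exact mem_indexRange (τ := 1) (fun _ => by simp) ⟨_, fun l => by simp, hC hv⟩

/-- When the mesh is negligible with respect to the scaling vectors, the boundary cells occupy a
negligible volume. -/
lemma tendsto_boundaryCells {d p : ℕ} (hd : 1 ≤ d) {κ : ℝ} (hκ : 0 < κ) {c : ℕ → Fin d → ℝ}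
    (hcpos : ∀ n l, 0 < c n l) {C : ℕ → Set (Fin d → ℝ)} (hC : ∀ n, IsPConvex p (C n))
    (hCκ : ∀ n, C n ⊆ scaledBox κ (c n)) {τ : ℕ → Fin d → ℤ} (hτ : ∀ n l, 0 < τ n l)
    (hτc : ∀ l, Tendsto (fun n => (τ n l : ℝ) / c n l) atTop (𝓝 0)) :
    Tendsto (fun n => (boundaryCells (τ n) (C n)).ncard * (∏ l, (τ n l : ℝ)) / ∏ l, c n l)
      atTop (𝓝 0) := by
  have hlim : Tendsto (fun n => (p : ℝ) * ∑ l, 2 * ∏ j, (if j = l then (d : ℝ) * (τ n j / c n j)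
      else 2 * κ + 2 * (τ n j / c n j))) atTop (𝓝 0) := by
    have h0 : (0 : ℝ) = p * ∑ l : Fin d, 2 * ∏ j : Fin d, (if j = l then (d : ℝ) * 0
      else 2 * κ + 2 * 0) := by
      have : ∀ l : Fin d, ∏ j : Fin d, (if j = l then (d : ℝ) * 0 else 2 * κ + 2 * 0) = 0 :=
        fun l => Finset.prod_eq_zero (Finset.mem_univ l) (by simp)
      rw [Finset.sum_eq_zero fun l _ => by rw [this, mul_zero], mul_zero]
    rw [h0]
    refine (tendsto_finsetSum _ fun l _ => (tendsto_finsetProd _ fun j _ => ?_).const_mul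
      2).const_mul _
    by_cases hj : j = l
    · simp only [hj, if_true]
      exact (hτc l).const_mul _
    · simp only [hj, if_false]
      exact ((hτc j).const_mul 2).const_add _
  have hτ' : ∀ n l, (0 : ℝ) < τ n l := fun n l => by exact_mod_cast hτ n l
  refine squeeze_zero (fun n => ?_) (fun n => ?_) hlim
  · exact div_nonneg (mul_nonneg (Nat.cast_nonneg _) (Finset.prod_nonneg fun l _ => (hτ' n l).le))
      (Finset.prod_nonneg fun l _ => (hcpos n l).le)
  · rw [mul_div_assoc, ← Finset.prod_div_distrib]
    refine (mul_le_mul_of_nonneg_right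
      (ncard_boundaryCells_isPConvex_le hd hκ (hcpos n) (hτ n) (hC n) (hCκ n))
      (Finset.prod_nonneg fun l _ => (div_pos (hτ' n l) (hcpos n l)).le)).trans_eq ?_
    rw [mul_assoc, Finset.sum_mul]
    congr 1
    refine Finset.sum_congr rfl fun l _ => ?_
    rw [mul_assoc, ← Finset.prod_mul_distrib]
    congr 1
    refine Finset.prod_congr rfl fun j _ => ?_
    have h1 := (hτ' n j).ne'
    have h2 := (hcpos n j).ne'
    split_ifs
    · rfl
    · field_simp

/-- The geometric assumption, as far as it is used: `|D_n|` is of the order of `∏ c_{n,ℓ}`, and the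
cells of a negligible mesh inside `D_n` contain almost all points of `D_n`. -/
lemma GeometricAssumption.asymptotics {d : ℕ} (hd : 1 ≤ d) {D : ℕ → Set (Fin d → ℤ)}
    {c : ℕ → Fin d → ℝ} (hD : GeometricAssumption D c) {τ : ℕ → Fin d → ℤ}
    (hτ : ∀ n l, 0 < τ n l) (hτc : ∀ l, Tendsto (fun n => (τ n l : ℝ) / c n l) atTop (𝓝 0)) :
    (∀ n, (D n).Finite) ∧ (∃ a : ℝ, 0 < a ∧ ∀ᶠ n in atTop, ((D n).ncard : ℝ) ≤ a * ∏ l, c n l) ∧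
    (∀ᶠ n in atTop, ∏ l, c n l ≤ 4 * (D n).ncard) ∧
    Tendsto (fun n => ((innerCells (τ n) (D n)).ncard * ∏ l, (τ n l : ℝ)) / (D n).ncard)
      atTop (𝓝 1) := by
  obtain ⟨p, C, hC, hDC, hvol, hcpos, hc, heq, κ, hκ, hCκ⟩ := hD
  have hDfin : ∀ n, (D n).Finite := fun n =>
    hDC n ▸ (Finset.finite_toSet _).subset (latticePoints_subset (hCκ n))
  have hprod : ∀ n, 0 < ∏ l, c n l := fun n => Finset.prod_pos fun l _ => hcpos n l
  have hB1 := tendsto_boundaryCells hd hκ hcpos hC hCκ (τ := fun _ => 1) (fun _ _ => by simp)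
    (fun l => by simpa [Function.comp_def] using tendsto_inv_atTop_zero.comp (hc l))
  have hB := tendsto_boundaryCells hd hκ hcpos hC hCκ hτ hτc
  have hlow : ∀ᶠ n in atTop, ∏ l, c n l ≤ 4 * (D n).ncard := by
    have h1 : Tendsto (fun n => volume.real (C n) / ∏ l, c n l) atTop (𝓝 1) :=
      (isEquivalent_iff_tendsto_one (Eventually.of_forall fun n => (hprod n).ne')).1 heq.symm
    filter_upwards [h1.eventually_const_le (show (1 / 2 : ℝ) < 1 by norm_num),
      hB1.eventually_le_const (show (0 : ℝ) < 1 / 4 by norm_num)] with n hn1 hn2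
    rw [le_div_iff₀ (hprod n)] at hn1
    rw [div_le_iff₀ (hprod n)] at hn2
    have h3 := volume_real_le (hDC n ▸ hDfin n) (finite_boundaryCells (fun _ => by simp) (hCκ n))
    rw [← hDC n] at h3
    simp only [Pi.one_apply, Int.cast_one, Finset.prod_const_one, mul_one] at hn2
    linarith
  refine ⟨hDfin, ⟨∏ _l : Fin d, (2 * κ + 2), by positivity, ?_⟩, hlow, ?_⟩
  · filter_upwards [eventually_all.2 fun l => (hc l).eventually_ge_atTop 1] with n hn
    rw [← Finset.prod_mul_distrib]
    have h := Set.ncard_le_ncard (latticePoints_subset (hCκ n)) (Finset.finite_toSet _)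
    rw [← hDC n, Set.ncard_coe_finset, Fintype.card_piFinset] at h
    refine (Nat.cast_le.2 h).trans ?_
    rw [Nat.cast_prod]
    refine Finset.prod_le_prod (fun _ _ => by positivity) fun l _ => ?_
    have := card_indexRange_le (κ := κ) (c := c n l) (τ := 1)
      (by simpa using (mul_pos hκ (hcpos n l)).le)
    simp only [Int.cast_one, div_one] at this
    nlinarith [hn l]
  · have hlim : Tendsto (fun n => 1 - 4 * ((boundaryCells (τ n) (C n)).ncard *
        (∏ l, (τ n l : ℝ)) / ∏ l, c n l)) atTop (𝓝 1) := by
      simpa using (hB.const_mul 4).const_sub 1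
    refine tendsto_of_tendsto_of_tendsto_of_le_of_le' hlim tendsto_const_nhds ?_ ?_
    · filter_upwards [hlow] with n hn
      have hN : (0 : ℝ) < (D n).ncard := by linarith [hprod n]
      have h1 := ncard_latticePoints_le (hτ n) (hDC n ▸ hDfin n)
        (finite_boundaryCells (hτ n) (hCκ n))
      rw [← hDC n] at h1
      rw [le_div_iff₀ hN]
      set b := (boundaryCells (τ n) (C n)).ncard * ∏ l, (τ n l : ℝ) with hb
      have hb0 : 0 ≤ b := mul_nonneg (Nat.cast_nonneg _)
        (Finset.prod_nonneg fun l _ => by exact_mod_cast (hτ n l).le)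
      have h2 : b ≤ 4 * (b / ∏ l, c n l) * (D n).ncard := by
        have : b = b / (∏ l, c n l) * ∏ l, c n l := by field_simp [(hprod n).ne']
        have h3 := mul_le_mul_of_nonneg_left hn (div_nonneg hb0 (hprod n).le)
        linarith
      linarith
    · filter_upwards [hlow] with n hn
      have hN : (0 : ℝ) < (D n).ncard := by linarith [hprod n]
      rw [div_le_one hN]
      exact ncard_innerCells_mul_le (hτ n) (hDfin n)


/-! ### Exceedances of a stationary field -/

section

variable {d : ℕ} {Ω : Type*}

/-- The event `M_ξ(A) ≤ x`. -/
def underLevel (ξ : (Fin d → ℤ) → Ω → ℝ) (x : ℝ) (A : Set (Fin d → ℤ)) : Set Ω :=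
  {ω | ∀ v ∈ A, ξ v ω ≤ x}

/-- The event `M_ξ(A_v) ≤ x < ξ_v`: the field exceeds `x` at `v`, and at no later point nearby. -/
def lastExceedance (ξ : (Fin d → ℤ) → Ω → ℝ) (x : ℝ) (le : (Fin d → ℤ) → (Fin d → ℤ) → Prop)
    (t v : Fin d → ℤ) : Set Ω :=
  {ω | (∀ z ∈ laterPoints le t v, ξ z ω ≤ x) ∧ x < ξ v ω}

variable {ξ : (Fin d → ℤ) → Ω → ℝ} {x : ℝ} {A B : Set (Fin d → ℤ)}

lemma fieldMax_le_iff {ω : Ω} : fieldMax ξ A ω ≤ (x : EReal) ↔ ∀ v ∈ A, ξ v ω ≤ x := by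
  simp [fieldMax, iSup_le_iff]

lemma underLevel_union : underLevel ξ x (A ∪ B) = underLevel ξ x A ∩ underLevel ξ x B := by
  ext ω
  simp only [underLevel, Set.mem_ofPred_eq, Set.mem_inter_iff, Set.mem_union]
  exact ⟨fun h => ⟨fun v hv => h v (Or.inl hv), fun v hv => h v (Or.inr hv)⟩,
    fun h v hv => hv.elim (h.1 v) (h.2 v)⟩

lemma underLevel_anti (h : A ⊆ B) : underLevel ξ x B ⊆ underLevel ξ x A :=
  fun _ hω v hv => hω v (h hv)

variable [MeasurableSpace Ω] {P : Measure Ω}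

lemma measurableSet_underLevel_pi (x : ℝ) (A : Set (Fin d → ℤ)) :
    MeasurableSet {f : (Fin d → ℤ) → ℝ | ∀ v ∈ A, f v ≤ x} := by
  have : {f : (Fin d → ℤ) → ℝ | ∀ v ∈ A, f v ≤ x} = ⋂ v ∈ A, {f | f v ≤ x} := by
    ext; simp
  rw [this]
  exact MeasurableSet.biInter A.to_countable fun v _ =>
    measurableSet_le (measurable_pi_apply v) measurable_const

lemma IsStationaryField.measurableSet_underLevel (hξ : IsStationaryField P ξ)
    (x : ℝ) (A : Set (Fin d → ℤ)) : MeasurableSet (underLevel ξ x A) :=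
  measurable_pi_lambda (fun ω v => ξ v ω) hξ.measurable (measurableSet_underLevel_pi x A)

lemma IsStationaryField.measurableSet_lastExceedance (hξ : IsStationaryField P ξ) (x : ℝ)
    (le : (Fin d → ℤ) → (Fin d → ℤ) → Prop) (t v : Fin d → ℤ) :
    MeasurableSet (lastExceedance ξ x le t v) :=
  (hξ.measurableSet_underLevel x _).inter (measurableSet_lt measurable_const (hξ.measurable v))

lemma IsStationaryField.measureReal_translate (hξ : IsStationaryField P ξ)
    {S : Set ((Fin d → ℤ) → ℝ)} (hS : MeasurableSet S) (h : Fin d → ℤ) :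
    P.real {ω | (fun v => ξ (v + h) ω) ∈ S} = P.real {ω | (fun v => ξ v ω) ∈ S} := by
  have h1 := congrArg (fun Q => Q.real S) (hξ.stationary h)
  rw [map_measureReal_apply (measurable_pi_lambda _ fun v => hξ.measurable _) hS,
    map_measureReal_apply (measurable_pi_lambda _ hξ.measurable) hS] at h1
  exact h1

lemma IsStationaryField.measureReal_underLevel_translate (hξ : IsStationaryField P ξ)
    (h : Fin d → ℤ) (hAB : ∀ v, v + h ∈ B ↔ v ∈ A) :
    P.real (underLevel ξ x B) = P.real (underLevel ξ x A) := by
  refine Eq.trans ?_ (hξ.measureReal_translate (measurableSet_underLevel_pi x A) h)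
  congr 1
  ext ω
  simp only [underLevel, Set.mem_ofPred_eq]
  constructor
  · exact fun hω v hv => hω _ ((hAB v).2 hv)
  · intro hω v hv
    have := hω (v - h) ((hAB _).1 (by simpa using hv))
    simpa using this

lemma IsStationaryField.measureReal_underLevel_block (hξ : IsStationaryField P ξ)
    (τ s i : Fin d → ℤ) :
    P.real (underLevel ξ x (block τ s i)) = P.real (underLevel ξ x (block τ s 0)) := by
  refine hξ.measureReal_underLevel_translate (τ * i) fun v => ?_
  simp only [Finset.mem_coe, mem_block, Pi.add_apply, Pi.mul_apply, Pi.zero_apply, mul_zero,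
    zero_add]
  refine forall_congr' fun l => ?_
  constructor <;> rintro ⟨h1, h2⟩ <;> constructor <;> linarith

lemma IsStationaryField.measureReal_exceed (hξ : IsStationaryField P ξ) (v : Fin d → ℤ) :
    P.real {ω | x < ξ v ω} = P.real {ω | x < ξ 0 ω} := by
  have := hξ.measureReal_translate (S := {f | x < f 0})
    (measurableSet_lt measurable_const (measurable_pi_apply 0)) v
  simpa using this

lemma mem_laterPoints_add {le : (Fin d → ℤ) → (Fin d → ℤ) → Prop}
    (hle : IsInvariantTotalOrder le) {t v z : Fin d → ℤ} :
    z + v ∈ laterPoints le t v ↔ z ∈ laterPoints le t 0 := by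
  have h1 : le v (z + v) ↔ le 0 z :=
    ⟨fun h => by simpa using hle.add_right _ _ (-v) h,
      fun h => by simpa using hle.add_right _ _ v h⟩
  have h2 : v ≠ z + v ↔ 0 ≠ z := by simp [eq_comm]
  simp only [laterPoints, Set.mem_ofPred_eq, h1, h2, Pi.add_apply, add_sub_cancel_right,
    Pi.zero_apply, sub_zero]

lemma IsStationaryField.measureReal_lastExceedance (hξ : IsStationaryField P ξ)
    {le : (Fin d → ℤ) → (Fin d → ℤ) → Prop} (hle : IsInvariantTotalOrder le) (t v : Fin d → ℤ) :
    P.real (lastExceedance ξ x le t v) = P.real (lastExceedance ξ x le t 0) := by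
  have h := hξ.measureReal_translate
    (S := {f | ∀ z ∈ laterPoints le t 0, f z ≤ x} ∩ {f | x < f 0})
    ((measurableSet_underLevel_pi x _).inter
      (measurableSet_lt measurable_const (measurable_pi_apply 0))) v
  refine Eq.trans ?_ h
  congr 1
  ext ω
  simp only [lastExceedance, Set.mem_ofPred_eq, Set.mem_inter_iff, zero_add]
  refine and_congr_left fun _ => ⟨fun hω z hz => hω _ ((mem_laterPoints_add hle).2 hz), ?_⟩
  intro hω z hz
  have := hω (z - v) ((mem_laterPoints_add hle (v := v)).1 (by simpa using hz))
  simpa using this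

/-- The events of a last exceedance at the different points of a small block are disjoint, and each
of them forces an exceedance in the block. -/
lemma IsStationaryField.measureReal_underLevel_le [IsProbabilityMeasure P]
    (hξ : IsStationaryField P ξ) {le : (Fin d → ℤ) → (Fin d → ℤ) → Prop}
    (hle : IsInvariantTotalOrder le) {t : Fin d → ℤ} {F : Finset (Fin d → ℤ)}
    (hF : ∀ v ∈ F, ∀ w ∈ F, ∀ l, |w l - v l| ≤ t l) :
    P.real (underLevel ξ x F) ≤ 1 - F.card * P.real (lastExceedance ξ x le t 0) := by
  have hdisj : (F : Set (Fin d → ℤ)).PairwiseDisjoint (lastExceedance ξ x le t) := by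
    intro v hv w hw hvw
    rw [Function.onFun, Set.disjoint_left]
    rintro ω ⟨h1, h2⟩ ⟨h3, h4⟩
    rcases hle.total v w with h | h
    · exact absurd (h1 w ⟨hF v hv w hw, h, hvw⟩) (not_le.2 h4)
    · exact absurd (h3 v ⟨hF w hw v hv, h, hvw.symm⟩) (not_le.2 h2)
  have h1 : ⋃ v ∈ F, lastExceedance ξ x le t v ⊆ (underLevel ξ x F)ᶜ := by
    simp only [Set.iUnion_subset_iff]
    intro v hv ω hω hu
    exact absurd (hu v hv) (not_le.2 hω.2)
  have h2 := measureReal_mono (μ := P) h1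
  rw [measureReal_biUnion_finset hdisj fun v _ => hξ.measurableSet_lastExceedance x le t v,
    Finset.sum_congr rfl fun v _ => hξ.measureReal_lastExceedance hle t v,
    probReal_compl_eq_one_sub (hξ.measurableSet_underLevel x _)] at h2
  simp only [Finset.sum_const, nsmul_eq_mul] at h2
  linarith

lemma IsStationaryField.measureReal_underLevel_compl_le [IsProbabilityMeasure P]
    (hξ : IsStationaryField P ξ) (F : Finset (Fin d → ℤ)) :
    P.real (underLevel ξ x F)ᶜ ≤ F.card * P.real {ω | x < ξ 0 ω} := by
  have h1 : (underLevel ξ x F)ᶜ ⊆ ⋃ v ∈ F, {ω | x < ξ v ω} := by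
    intro ω hω
    simp only [underLevel, Set.mem_compl_iff, Set.mem_ofPred_eq, not_forall, not_le] at hω
    obtain ⟨v, hv, h⟩ := hω
    simp only [Set.mem_iUnion]
    exact ⟨v, hv, h⟩
  refine (measureReal_mono h1 (measure_ne_top _ _)).trans
    ((measureReal_biUnion_finset_le _ _).trans ?_)
  rw [Finset.sum_congr rfl fun v _ => hξ.measureReal_exceed v]
  simp

lemma IsInvariantTotalOrder.exists_last {le : (Fin d → ℤ) → (Fin d → ℤ) → Prop}
    (hle : IsInvariantTotalOrder le) {F : Finset (Fin d → ℤ)} (hF : F.Nonempty) :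
    ∃ v ∈ F, ∀ w ∈ F, le w v := by
  induction hF using Finset.Nonempty.cons_induction with
  | singleton a => exact ⟨a, by simp, fun w hw => by simp at hw; exact hw ▸ hle.refl _⟩
  | cons a F ha _ ih =>
    obtain ⟨v, hv, h⟩ := ih
    rcases hle.total a v with hav | hva
    · refine ⟨v, by simp [hv], fun w hw => ?_⟩
      rcases Finset.mem_cons.1 hw with rfl | hw
      exacts [hav, h w hw]
    · refine ⟨a, by simp, fun w hw => ?_⟩
      rcases Finset.mem_cons.1 hw with rfl | hw
      exacts [hle.refl _, hle.trans _ _ _ (h w hw) hva]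

/-- If a block `F` contains an exceedance, then its last one is a last exceedance for the field
unless there is an exceedance in the gap `G` around the block or in the remainder `R` of the
neighbourhood. -/
lemma IsStationaryField.measureReal_compl_underLevel_le_add [IsProbabilityMeasure P]
    (hξ : IsStationaryField P ξ) {le : (Fin d → ℤ) → (Fin d → ℤ) → Prop}
    (hle : IsInvariantTotalOrder le) {t : Fin d → ℤ} {F G R : Finset (Fin d → ℤ)}
    (hF : ∀ v ∈ F, ∀ z ∈ laterPoints le t v, z ∈ F ∨ z ∈ G ∨ z ∈ R) :
    P.real (underLevel ξ x F)ᶜ ≤ F.card * P.real (lastExceedance ξ x le t 0) +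
      G.card * P.real {ω | x < ξ 0 ω} +
      P.real ((underLevel ξ x F)ᶜ ∩ (underLevel ξ x R)ᶜ) := by
  classical
  have hsub : (underLevel ξ x F)ᶜ ⊆ ((⋃ v ∈ F, lastExceedance ξ x le t v) ∪ (underLevel ξ x G)ᶜ) ∪
      ((underLevel ξ x F)ᶜ ∩ (underLevel ξ x R)ᶜ) := by
    intro ω hω
    by_cases hG : ω ∈ underLevel ξ x G
    · by_cases hR : ω ∈ underLevel ξ x R
      · left; left
        have hne : (F.filter fun v => x < ξ v ω).Nonempty := by
          simp only [underLevel, Set.mem_compl_iff, Set.mem_ofPred_eq, not_forall, not_le] at hω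
          obtain ⟨v, hv, h⟩ := hω
          exact ⟨v, Finset.mem_filter.2 ⟨hv, h⟩⟩
        obtain ⟨v, hv, hmax⟩ := hle.exists_last hne
        rw [Finset.mem_filter] at hv
        simp only [Set.mem_iUnion]
        refine ⟨v, hv.1, fun z hz => ?_, hv.2⟩
        rcases hF v hv.1 z hz with h | h | h
        · by_contra! hlt
          exact hz.2.2 (hle.antisymm _ _ hz.2.1 (hmax z (Finset.mem_filter.2 ⟨h, hlt⟩)))
        · exact hG z h
        · exact hR z h
      · exact Or.inr ⟨hω, hR⟩
    · exact Or.inl (Or.inr hG)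
  have h1 : P.real (⋃ v ∈ F, lastExceedance ξ x le t v) ≤
      F.card * P.real (lastExceedance ξ x le t 0) := by
    refine (measureReal_biUnion_finset_le _ _).trans ?_
    rw [Finset.sum_congr rfl fun v _ => hξ.measureReal_lastExceedance hle t v]
    simp
  have h2 := hξ.measureReal_underLevel_compl_le (x := x) G
  refine (measureReal_mono hsub).trans ((measureReal_union_le _ _).trans ?_)
  have h3 := measureReal_union_le (μ := P) (⋃ v ∈ F, lastExceedance ξ x le t v)
    (underLevel ξ x G)ᶜ
  linarith

/-! ### Consequences of mixing -/

lemma separated_of_gap {γ : Fin d → ℝ}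
    (h : ∀ a ∈ A, ∀ b ∈ B, ∃ l, ⌊|γ l|⌋ + 1 ≤ |b l - a l|) : Separated γ A B := by
  rintro b hb ⟨a, ha, u, hu, hab⟩
  obtain ⟨l, hl⟩ := h a ha b hb
  have h1 : u l ^ 2 ≤ 1 :=
    (Finset.single_le_sum (fun j _ => sq_nonneg (u j)) (Finset.mem_univ l)).trans hu
  have h2 : |u l| ≤ 1 := (sq_le_one_iff_abs_le_one _).1 h1
  have h3 : (⌊|γ l|⌋ : ℝ) + 1 ≤ |(b l : ℝ) - a l| := by exact_mod_cast hl
  rw [hab l, add_sub_cancel_left, abs_mul] at h3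
  nlinarith [abs_nonneg (γ l), Int.lt_floor_add_one |γ l|]

lemma IsStationaryField.measureReal_compl_inter_le [IsProbabilityMeasure P]
    (hξ : IsStationaryField P ξ) {α : ℝ}
    (h : |P.real (underLevel ξ x (A ∪ B)) -
      P.real (underLevel ξ x A) * P.real (underLevel ξ x B)| ≤ α) :
    P.real ((underLevel ξ x A)ᶜ ∩ (underLevel ξ x B)ᶜ) ≤
      P.real (underLevel ξ x A)ᶜ * P.real (underLevel ξ x B)ᶜ + α := by
  have hA := hξ.measurableSet_underLevel x A
  have hB := hξ.measurableSet_underLevel x B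
  rw [underLevel_union] at h
  rw [← Set.compl_union, probReal_compl_eq_one_sub hA, probReal_compl_eq_one_sub hB,
    probReal_compl_eq_one_sub (hA.union hB)]
  have := measureReal_union_add_inter (μ := P) (s := underLevel ξ x A) hB
  linarith [(abs_le.1 h).2]

/-- Mixing applied to one block after the other. -/
lemma abs_measureReal_underLevel_biUnion_sub_le [IsProbabilityMeasure P] {ι : Type*}
    {I : Finset ι} {F : ι → Set (Fin d → ℤ)} {α r : ℝ}
    (hr : ∀ i ∈ I, P.real (underLevel ξ x (F i)) = r)
    (h : ∀ J ⊆ I, ∀ i ∈ I, i ∉ J → |P.real (underLevel ξ x ((⋃ j ∈ J, F j) ∪ F i)) -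
      P.real (underLevel ξ x (⋃ j ∈ J, F j)) * P.real (underLevel ξ x (F i))| ≤ α) :
    |P.real (underLevel ξ x (⋃ i ∈ I, F i)) - r ^ I.card| ≤ I.card * α := by
  classical
  induction I using Finset.induction_on with
  | empty => simp [underLevel]
  | insert i I hi ih =>
    have h1 := ih (fun j hj => hr j (Finset.mem_insert_of_mem hj)) fun J hJ j hj hjJ =>
      h J (hJ.trans (Finset.subset_insert _ _)) j (Finset.mem_insert_of_mem hj) hjJ
    have h2 := h I (Finset.subset_insert _ _) i (Finset.mem_insert_self _ _) hi
    have hri := hr i (Finset.mem_insert_self _ _)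
    rw [hri] at h2
    have hr0 : 0 ≤ r := hri ▸ measureReal_nonneg
    have hr1 : r ≤ 1 := hri ▸ measureReal_le_one
    rw [Finset.set_biUnion_insert, Set.union_comm, Finset.card_insert_of_notMem hi, pow_succ]
    push_cast
    set a := P.real (underLevel ξ x (⋃ j ∈ I, F j))
    have h3 : |a * r - r ^ I.card * r| ≤ I.card * α := by
      rw [← sub_mul, abs_mul, abs_of_nonneg hr0]
      exact (mul_le_of_le_one_right (abs_nonneg _) hr1).trans h1
    rw [abs_le] at *
    constructor <;> linarith [h2.1, h2.2, h3.1, h3.2]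

end


/-! ### Elementary inequalities for the exponential -/

lemma exp_neg_le_one_sub_add_sq {p : ℝ} (hp : 0 ≤ p) : Real.exp (-p) ≤ 1 - p + p ^ 2 := by
  have h1 := Real.add_one_le_exp p
  rw [Real.exp_neg]
  refine inv_le_of_inv_le₀ (by nlinarith [sq_nonneg (p - 1)]) (le_trans ?_ h1)
  rw [inv_le_iff_one_le_mul₀ (by nlinarith [sq_nonneg (p - 1)])]
  nlinarith [pow_nonneg hp 3]

lemma one_sub_pow_le_exp {p : ℝ} (hp : p ≤ 1) (m : ℕ) :
    (1 - p) ^ m ≤ Real.exp (-(m * p)) := by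
  have := pow_le_pow_left₀ (sub_nonneg.2 hp) (Real.one_sub_le_exp_neg p) m
  rwa [← Real.exp_nat_mul, mul_neg] at this

lemma exp_le_one_sub_pow_add {p : ℝ} (hp0 : 0 ≤ p) (hp1 : p ≤ 1) (m : ℕ) :
    Real.exp (-(m * p)) ≤ (1 - p) ^ m + m * p ^ 2 := by
  induction m with
  | zero => simp
  | succ m ih =>
    have h1 : Real.exp (-((m + 1 : ℕ) * p)) = Real.exp (-(m * p)) * Real.exp (-p) := by
      rw [← Real.exp_add]; push_cast; ring_nf
    have h2 : Real.exp (-p) ≤ 1 := Real.exp_le_one_iff.2 (by linarith)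
    have h3 : (1 - p) ^ m ≤ 1 := pow_le_one₀ (by linarith) (by linarith)
    have h4 : 0 ≤ (1 - p) ^ m := pow_nonneg (by linarith) m
    have h5 := exp_neg_le_one_sub_add_sq hp0
    have h6 := mul_le_mul_of_nonneg_right ih (Real.exp_pos (-p)).le
    have h7 := mul_le_mul_of_nonneg_left h5 h4
    have h8 : (m : ℝ) * p ^ 2 * Real.exp (-p) ≤ m * p ^ 2 :=
      mul_le_of_le_one_right (by positivity) h2
    have h9 : (1 - p) ^ m * p ^ 2 ≤ p ^ 2 := mul_le_of_le_one_left (sq_nonneg p) h3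
    rw [h1, pow_succ]
    push_cast
    nlinarith

lemma exp_neg_le_exp_neg_add {y z : ℝ} (hy : 0 ≤ y) (hyz : y ≤ z) :
    Real.exp (-y) ≤ Real.exp (-z) + (z - y) := by
  have h1 : Real.exp (-z) = Real.exp (-y) * Real.exp (-(z - y)) := by
    rw [← Real.exp_add]; ring_nf
  have h2 := Real.one_sub_le_exp_neg (z - y)
  have h3 : Real.exp (-y) ≤ 1 := Real.exp_le_one_iff.2 (by linarith)
  have h4 := mul_le_mul_of_nonneg_left h2 (Real.exp_pos (-y)).le
  have h5 : Real.exp (-y) * (z - y) ≤ z - y := mul_le_of_le_one_left (by linarith) h3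
  nlinarith

/-- The difference between `exp (- r y)` and `exp (- y)` is small uniformly in `y ≥ 0` as
`r → 1`. -/
lemma exp_neg_mul_le {r y : ℝ} (hr0 : 0 < r) (hr1 : r ≤ 1) :
    Real.exp (-(r * y)) ≤ Real.exp (-y) + (1 - r) / r := by
  have h1 : Real.exp (-y) = Real.exp (-(r * y)) * Real.exp (-((1 - r) * y)) := by
    rw [← Real.exp_add]; ring_nf
  have h2 := Real.one_sub_le_exp_neg ((1 - r) * y)
  have h4 := mul_le_mul_of_nonneg_left h2 (Real.exp_pos (-(r * y))).le
  have h5 : Real.exp (-(r * y)) * (r * y) ≤ 1 := by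
    have h6 := Real.add_one_le_exp (r * y)
    rw [Real.exp_neg, inv_mul_le_iff₀ (Real.exp_pos _)]
    linarith
  have h6 : Real.exp (-(r * y)) * ((1 - r) * y) ≤ (1 - r) / r := by
    rw [le_div_iff₀ hr0]
    have := mul_le_mul_of_nonneg_left h5 (sub_nonneg.2 hr1)
    nlinarith
  nlinarith

/-! ### Estimates for one index set -/

section

variable {d : ℕ} {Ω : Type*} [MeasurableSpace Ω] {P : Measure Ω} [IsProbabilityMeasure P]
  {ξ : (Fin d → ℤ) → Ω → ℝ} {x α : ℝ} {K D : Set (Fin d → ℤ)} {γ : Fin d → ℝ} {t s : Fin d → ℤ}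
  {I : Finset (Fin d → ℤ)} {le : (Fin d → ℤ) → (Fin d → ℤ) → Prop}

lemma isBox_block (τ s i : Fin d → ℤ) : IsBox (block τ s i : Set (Fin d → ℤ)) :=
  ⟨_, _, Finset.coe_Icc _ _⟩

lemma block_subset_block {τ i : Fin d → ℤ} (hs : ∀ l, s l ≤ τ l) :
    block τ s i ⊆ block τ τ i := by
  intro v hv
  rw [mem_block] at *
  exact fun l => ⟨(hv l).1, by linarith [(hv l).2, hs l]⟩

/-- The maximum over well separated blocks behaves like a maximum of independent block maxima. -/
lemma IsStationaryField.abs_measureReal_blocks_sub_le (hξ : IsStationaryField P ξ)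
    (hmix : ∀ A B : Set (Fin d → ℤ), A ⊆ K → B ⊆ K → Separated γ A B → (IsBox A ∨ IsBox B) →
      |P.real (underLevel ξ x (A ∪ B)) -
        P.real (underLevel ξ x A) * P.real (underLevel ξ x B)| ≤ α)
    (ht : ∀ l, 0 ≤ t l) (hs : ∀ l, s l = t l + 1 - ⌊|γ l|⌋) (hDK : D ⊆ K)
    (hI : (I : Set (Fin d → ℤ)) ⊆ innerCells (t + 1) D) :
    |P.real (underLevel ξ x (⋃ i ∈ I, (block (t + 1) s i : Set (Fin d → ℤ)))) -
      P.real (underLevel ξ x (block (t + 1) s 0)) ^ I.card| ≤ I.card * α := by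
  have hsub : ∀ i ∈ I, (block (t + 1) s i : Set (Fin d → ℤ)) ⊆ K := fun i hi =>
    (Finset.coe_subset.2 (block_subset_block fun l => by
      have : 0 ≤ ⌊|γ l|⌋ := Int.floor_nonneg.2 (abs_nonneg _)
      simp only [hs l, Pi.add_apply, Pi.one_apply]; linarith)).trans ((hI hi).trans hDK)
  refine abs_measureReal_underLevel_biUnion_sub_le
    (fun i _ => hξ.measureReal_underLevel_block _ _ i) fun J hJ i hi hiJ => ?_
  refine hmix _ _ (Set.iUnion₂_subset fun j hj => hsub j (hJ hj)) (hsub i hi)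
    (separated_of_gap ?_) (Or.inr (isBox_block _ _ _))
  intro a ha b hb
  simp only [Set.mem_iUnion, Finset.mem_coe] at ha hb
  obtain ⟨j, hj, ha⟩ := ha
  obtain ⟨l, hl⟩ := exists_gap_of_mem_block (fun l => by simp; linarith [ht l])
    (fun h : j = i => hiJ (h ▸ hj)) ha hb
  refine ⟨l, ?_⟩
  simp only [hs l, Pi.add_apply, Pi.one_apply] at hl
  linarith

/-- The upper bound for the maximum over one index set. -/
lemma IsStationaryField.measureReal_underLevel_le_exp (hξ : IsStationaryField P ξ)
    (hle : IsInvariantTotalOrder le)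
    (hmix : ∀ A B : Set (Fin d → ℤ), A ⊆ K → B ⊆ K → Separated γ A B → (IsBox A ∨ IsBox B) →
      |P.real (underLevel ξ x (A ∪ B)) -
        P.real (underLevel ξ x A) * P.real (underLevel ξ x B)| ≤ α)
    (ht : ∀ l, 0 ≤ t l) (hs : ∀ l, s l = t l + 1 - ⌊|γ l|⌋) (hs1 : ∀ l, 1 ≤ s l) (hDK : D ⊆ K)
    (hI : (I : Set (Fin d → ℤ)) ⊆ innerCells (t + 1) D) :
    P.real (underLevel ξ x D) ≤
      Real.exp (-(I.card * ((∏ l, (s l : ℝ)) * P.real (lastExceedance ξ x le t 0)))) +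
        I.card * α := by
  have hg : ∀ l, 0 ≤ ⌊|γ l|⌋ := fun l => Int.floor_nonneg.2 (abs_nonneg _)
  have h1 := hξ.abs_measureReal_blocks_sub_le hmix ht hs hDK hI
  have h2 : P.real (underLevel ξ x D) ≤
      P.real (underLevel ξ x (⋃ i ∈ I, (block (t + 1) s i : Set (Fin d → ℤ)))) := by
    refine measureReal_mono (underLevel_anti (Set.iUnion₂_subset fun i hi => ?_))
    refine (Finset.coe_subset.2 (block_subset_block fun l => ?_)).trans (hI hi)
    simp only [hs l, Pi.add_apply, Pi.one_apply]; linarith [hg l]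
  have h3 := hξ.measureReal_underLevel_le (x := x) hle (t := t) (F := block (t + 1) s 0) (by
    intro v hv w hw l
    have hv := mem_block.1 hv l
    have hw := mem_block.1 hw l
    have := hs l
    rw [abs_le]; constructor <;> linarith [hg l, hv.1, hv.2, hw.1, hw.2])
  rw [card_block fun l => by linarith [hs1 l]] at h3
  have h4 := pow_le_pow_left₀ measureReal_nonneg h3 I.card
  have h5 := one_sub_pow_le_exp (p := (∏ l, (s l : ℝ)) * P.real (lastExceedance ξ x le t 0))
    (by linarith [measureReal_nonneg (μ := P) (s := underLevel ξ x (block (t + 1) s 0))]) I.card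
  linarith [(abs_le.1 h1).2]

/-- A block contains an exceedance hardly more often than the expected number of its last
exceedances says. -/
lemma IsStationaryField.measureReal_compl_block_le (hξ : IsStationaryField P ξ)
    (hle : IsInvariantTotalOrder le)
    (hmix : ∀ A B : Set (Fin d → ℤ), A ⊆ K → B ⊆ K → Separated γ A B → (IsBox A ∨ IsBox B) →
      |P.real (underLevel ξ x (A ∪ B)) -
        P.real (underLevel ξ x A) * P.real (underLevel ξ x B)| ≤ α)
    (ht : ∀ l, 0 ≤ t l) (hs : ∀ l, s l = t l + 1 - ⌊|γ l|⌋) (hs1 : ∀ l, 1 ≤ s l)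
    (hK : ∀ v : Fin d → ℤ, (∀ l, |v l| ≤ 2 * (t l + 1)) → v ∈ K) :
    P.real (underLevel ξ x (block (t + 1) s 0))ᶜ ≤
      (∏ l, (s l : ℝ)) * P.real (lastExceedance ξ x le t 0) +
      ((∏ l, ((s l : ℝ) + 2 * ⌊|γ l|⌋)) - ∏ l, (s l : ℝ)) * P.real {ω | x < ξ 0 ω} +
      ((∏ l, (s l : ℝ)) * P.real {ω | x < ξ 0 ω}) *
        ((3 ^ d * ∏ l, ((t l : ℝ) + 1)) * P.real {ω | x < ξ 0 ω}) + α := by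
  classical
  have hg : ∀ l, 0 ≤ ⌊|γ l|⌋ := fun l => Int.floor_nonneg.2 (abs_nonneg _)
  set u := P.real {ω | x < ξ 0 ω}
  have hu : 0 ≤ u := measureReal_nonneg
  set F := block (t + 1) s 0
  -- The block with a gap of the mixing distance around it, and with the range of `A_v` around it.
  set J : Finset (Fin d → ℤ) := Finset.Icc (fun l => -⌊|γ l|⌋) (fun l => s l - 1 + ⌊|γ l|⌋) with hJ
  set N : Finset (Fin d → ℤ) := Finset.Icc (fun l => -t l) (fun l => s l - 1 + t l) with hN
  have memF : ∀ v, v ∈ F ↔ ∀ l, 0 ≤ v l ∧ v l ≤ s l - 1 := fun v => by simp [F, mem_block]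
  have memJ : ∀ v, v ∈ J ↔ ∀ l, -⌊|γ l|⌋ ≤ v l ∧ v l ≤ s l - 1 + ⌊|γ l|⌋ := fun v => by
    simp [hJ, Pi.le_def, forall_and]
  have memN : ∀ v, v ∈ N ↔ ∀ l, -t l ≤ v l ∧ v l ≤ s l - 1 + t l := fun v => by
    simp [hN, Pi.le_def, forall_and]
  have hFJ : F ⊆ J := fun v hv => (memJ v).2 fun l => by
    have := (memF v).1 hv l; constructor <;> linarith [hg l, this.1, this.2]
  have hcF : (F.card : ℝ) = ∏ l, (s l : ℝ) := card_block fun l => by linarith [hs1 l]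
  have hcJ : (J.card : ℝ) = ∏ l, ((s l : ℝ) + 2 * ⌊|γ l|⌋) := by
    rw [hJ, card_Icc_pi fun l => by linarith [hs1 l, hg l]]
    refine Finset.prod_congr rfl fun l _ => ?_
    push_cast; ring
  have hcN : (N.card : ℝ) ≤ 3 ^ d * ∏ l, ((t l : ℝ) + 1) := by
    rw [hN, card_Icc_pi fun l => by linarith [hs1 l, ht l]]
    have : (3 : ℝ) ^ d = ∏ _l : Fin d, (3 : ℝ) := by simp
    rw [this, ← Finset.prod_mul_distrib]
    refine Finset.prod_le_prod (fun l _ => ?_) fun l _ => ?_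
    · have h1 : (1 : ℝ) ≤ s l := by exact_mod_cast hs1 l
      have h2 : (0 : ℝ) ≤ t l := by exact_mod_cast ht l
      push_cast; linarith
    · have h1 : (s l : ℝ) ≤ t l + 1 := by exact_mod_cast (by linarith [hs l, hg l])
      push_cast; linarith
  have h1 := hξ.measureReal_compl_underLevel_le_add (x := x) hle (t := t) (F := F) (G := J \ F)
    (R := N \ J) (by
      intro v hv z hz
      have hzN : z ∈ N := (memN z).2 fun l => by
        have := (memF v).1 hv l
        have h := abs_le.1 (hz.1 l)
        constructor <;> linarith [h.1, h.2, this.1, this.2]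
      by_cases hzF : z ∈ F
      · exact Or.inl hzF
      by_cases hzJ : z ∈ J
      · exact Or.inr (Or.inl (Finset.mem_sdiff.2 ⟨hzJ, hzF⟩))
      · exact Or.inr (Or.inr (Finset.mem_sdiff.2 ⟨hzN, hzJ⟩)))
  have hsep : Separated γ (F : Set (Fin d → ℤ)) (N \ J : Finset _) := by
    refine separated_of_gap fun a ha b hb => ?_
    have hbJ := (Finset.mem_sdiff.1 (Finset.mem_coe.1 hb)).2
    rw [memJ, not_forall] at hbJ
    obtain ⟨l, hl⟩ := hbJ
    refine ⟨l, ?_⟩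
    have hal := (memF a).1 ha l
    by_cases h : -⌊|γ l|⌋ ≤ b l
    · have h' : s l - 1 + ⌊|γ l|⌋ < b l := by
        by_contra! h''
        exact hl ⟨h, h''⟩
      exact le_trans (by linarith [hal.2]) (le_abs_self _)
    · push Not at h
      exact le_trans (by linarith [hal.1]) (neg_le_abs _)
  have hst : ∀ l, s l ≤ t l + 1 := fun l => by linarith [hs l, hg l]
  have h2 := hξ.measureReal_compl_inter_le (hmix F (N \ J : Finset _)
    (fun v hv => hK v fun l => by
      have := (memF v).1 hv l
      rw [abs_le]; constructor <;> linarith [this.1, this.2, hst l, ht l])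
    (fun v hv => hK v fun l => by
      have := (memN v).1 (Finset.mem_sdiff.1 (Finset.mem_coe.1 hv)).1 l
      rw [abs_le]; constructor <;> linarith [this.1, this.2, hst l, ht l])
    hsep (Or.inl (isBox_block _ _ _)))
  have h3 := hξ.measureReal_underLevel_compl_le (x := x) F
  have h4 : P.real (underLevel ξ x ((N \ J : Finset _) : Set (Fin d → ℤ)))ᶜ ≤
      (3 ^ d * ∏ l, ((t l : ℝ) + 1)) * u := by
    refine (hξ.measureReal_underLevel_compl_le (x := x) (N \ J)).trans
      (mul_le_mul_of_nonneg_right (le_trans ?_ hcN) hu)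
    exact_mod_cast Finset.card_le_card Finset.sdiff_subset
  have h5 : (((J \ F).card : ℕ) : ℝ) = (∏ l, ((s l : ℝ) + 2 * ⌊|γ l|⌋)) - ∏ l, (s l : ℝ) := by
    rw [Finset.card_sdiff_of_subset hFJ, Nat.cast_sub (Finset.card_le_card hFJ), hcF, hcJ]
  rw [hcF] at h1 h3
  rw [h5] at h1
  have h6 := mul_le_mul h3 h4 measureReal_nonneg (measureReal_nonneg.trans h3)
  linarith

/-- The lower bound for the maximum over one index set. -/
lemma IsStationaryField.exp_le_measureReal_underLevel_add (hξ : IsStationaryField P ξ)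
    (hle : IsInvariantTotalOrder le)
    (hmix : ∀ A B : Set (Fin d → ℤ), A ⊆ K → B ⊆ K → Separated γ A B → (IsBox A ∨ IsBox B) →
      |P.real (underLevel ξ x (A ∪ B)) -
        P.real (underLevel ξ x A) * P.real (underLevel ξ x B)| ≤ α)
    (ht : ∀ l, 0 ≤ t l) (hs : ∀ l, s l = t l + 1 - ⌊|γ l|⌋) (hs1 : ∀ l, 1 ≤ s l) (hDK : D ⊆ K)
    (hI : (I : Set (Fin d → ℤ)) ⊆ innerCells (t + 1) D) (hDfin : D.Finite)
    (hK : ∀ v : Fin d → ℤ, (∀ l, |v l| ≤ 2 * (t l + 1)) → v ∈ K) :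
    Real.exp (-(I.card * ((∏ l, (s l : ℝ)) * P.real (lastExceedance ξ x le t 0)))) ≤
      P.real (underLevel ξ x D) +
      ((D.ncard - I.card * ∏ l, (s l : ℝ)) * P.real {ω | x < ξ 0 ω} +
      I.card * ((∏ l, (s l : ℝ)) * P.real {ω | x < ξ 0 ω}) ^ 2 +
      I.card * (((∏ l, ((s l : ℝ) + 2 * ⌊|γ l|⌋)) - ∏ l, (s l : ℝ)) * P.real {ω | x < ξ 0 ω} +
        ((∏ l, (s l : ℝ)) * P.real {ω | x < ξ 0 ω}) *
          ((3 ^ d * ∏ l, ((t l : ℝ) + 1)) * P.real {ω | x < ξ 0 ω})) + 2 * (I.card * α)) := by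
  classical
  have hg : ∀ l, 0 ≤ ⌊|γ l|⌋ := fun l => Int.floor_nonneg.2 (abs_nonneg _)
  have hst : ∀ l, s l ≤ (t + 1) l := fun l => by
    simp only [hs l, Pi.add_apply, Pi.one_apply]; linarith [hg l]
  have hs0 : ∀ l, 0 ≤ s l := fun l => by linarith [hs1 l]
  have hblocks := hξ.abs_measureReal_blocks_sub_le hmix ht hs hDK hI
  have hcompl := hξ.measureReal_compl_block_le hle hmix ht hs hs1 hK
  have hq := hξ.measureReal_underLevel_le (x := x) hle (t := t) (F := block (t + 1) s 0) (by
    intro v hv w hw l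
    have hv := mem_block.1 hv l
    have hw := mem_block.1 hw l
    have := hs l
    rw [abs_le]; constructor <;> linarith [hg l, hv.1, hv.2, hw.1, hw.2])
  have hbu := hξ.measureReal_underLevel_compl_le (x := x) (block (t + 1) s 0)
  rw [probReal_compl_eq_one_sub (hξ.measurableSet_underLevel _ _)] at hcompl hbu
  rw [card_block hs0] at hq hbu
  -- The points of `D` outside the blocks.
  set U : Finset (Fin d → ℤ) := I.biUnion (block (t + 1) s) with hU
  have hUset : (U : Set (Fin d → ℤ)) = ⋃ i ∈ I, (block (t + 1) s i : Set (Fin d → ℤ)) := by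
    simp [hU]
  have hUD : U ⊆ hDfin.toFinset := by
    rw [← Finset.coe_subset, hUset, Set.Finite.coe_toFinset]
    exact Set.iUnion₂_subset fun i hi =>
      (Finset.coe_subset.2 (block_subset_block hst)).trans (hI hi)
  have hrest : P.real (underLevel ξ x (⋃ i ∈ I, (block (t + 1) s i : Set (Fin d → ℤ)))) ≤
      P.real (underLevel ξ x D) +
        (D.ncard - I.card * ∏ l, (s l : ℝ)) * P.real {ω | x < ξ 0 ω} := by
    have h1 := hξ.measureReal_underLevel_compl_le (x := x) (hDfin.toFinset \ U)
    rw [Finset.card_sdiff_of_subset hUD, Nat.cast_sub (Finset.card_le_card hUD),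
      card_biUnion_block (fun l => by simp; linarith [ht l]) hs0 hst,
      ← Set.ncard_eq_toFinset_card D hDfin] at h1
    have h2 : underLevel ξ x (⋃ i ∈ I, (block (t + 1) s i : Set (Fin d → ℤ))) ⊆
        underLevel ξ x D ∪ (underLevel ξ x (hDfin.toFinset \ U : Finset _))ᶜ := by
      intro ω hω
      by_cases h : ω ∈ underLevel ξ x (hDfin.toFinset \ U : Finset _)
      · refine Or.inl fun v hv => ?_
        by_cases hvU : v ∈ U
        · exact hω v (hUset ▸ hvU)
        · exact h v (by simp [hv, hvU])
      · exact Or.inr h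
    have h3 := (measureReal_mono (μ := P) h2).trans (measureReal_union_le _ _)
    linarith
  set b := ∏ l, (s l : ℝ)
  set u := P.real {ω | x < ξ 0 ω}
  set q := P.real (lastExceedance ξ x le t 0)
  set p := 1 - P.real (underLevel ξ x (block (t + 1) s 0)) with hp
  have hp0 : 0 ≤ p := sub_nonneg.2 measureReal_le_one
  have hp1 : p ≤ 1 := sub_le_self _ measureReal_nonneg
  have hpow := exp_le_one_sub_pow_add hp0 hp1 I.card
  have hbq : 0 ≤ b * q := mul_nonneg
    (Finset.prod_nonneg fun l _ => by exact_mod_cast hs0 l) measureReal_nonneg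
  have hm : (0 : ℝ) ≤ I.card := Nat.cast_nonneg _
  have hexp := exp_neg_le_exp_neg_add (y := I.card * (b * q)) (z := I.card * p)
    (mul_nonneg hm hbq) (mul_le_mul_of_nonneg_left (by linarith) hm)
  have hsq : I.card * p ^ 2 ≤ I.card * (b * u) ^ 2 :=
    mul_le_mul_of_nonneg_left (pow_le_pow_left₀ hp0 hbu 2) hm
  have hpe := mul_le_mul_of_nonneg_left hcompl hm
  have hp' : 1 - p = P.real (underLevel ξ x (block (t + 1) s 0)) := by rw [hp]; ring
  rw [hp'] at hpow
  linarith [(abs_le.1 hblocks).1]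

end


/-! ### Passage to the limit -/

lemma sideLength_nonneg {d : ℕ} {c : Fin d → ℝ} (hc : ∀ l, 0 < c l) (k : ℕ) (l : Fin d) :
    0 ≤ sideLength c k l :=
  Int.floor_nonneg.2 (div_nonneg (hc l).le (Real.rpow_nonneg (Nat.cast_nonneg _) _))

lemma div_lt_sideLength_add_one {d : ℕ} (c : Fin d → ℝ) (k : ℕ) (l : Fin d) :
    c l / (k : ℝ) ^ (1 / (d : ℝ)) < sideLength c k l + 1 :=
  Int.lt_floor_add_one _

lemma tendsto_rpow_one_div {d : ℕ} (hd : 1 ≤ d) {k : ℕ → ℕ} (hk : Tendsto k atTop atTop) :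
    Tendsto (fun n => (k n : ℝ) ^ (1 / (d : ℝ))) atTop atTop :=
  (tendsto_rpow_atTop (by positivity)).comp (tendsto_natCast_atTop_atTop.comp hk)

lemma tendsto_sideLength_div {d : ℕ} (hd : 1 ≤ d) {c : ℕ → Fin d → ℝ} (hcpos : ∀ n l, 0 < c n l)
    (hc : ∀ l, Tendsto (fun n => c n l) atTop atTop) {k : ℕ → ℕ} (hk : Tendsto k atTop atTop)
    (l : Fin d) :
    Tendsto (fun n => ((sideLength (c n) (k n) l : ℝ) + 1) / c n l) atTop (𝓝 0) := by
  have h1 : Tendsto (fun n => ((k n : ℝ) ^ (1 / (d : ℝ)))⁻¹ + (c n l)⁻¹) atTop (𝓝 0) := by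
    simpa [Function.comp_def] using (tendsto_inv_atTop_zero.comp (tendsto_rpow_one_div hd hk)).add
      (tendsto_inv_atTop_zero.comp (hc l))
  refine squeeze_zero (fun n => ?_) (fun n => ?_) h1
  · have : (0 : ℝ) ≤ sideLength (c n) (k n) l := by exact_mod_cast sideLength_nonneg (hcpos n) _ _
    exact div_nonneg (by linarith) (hcpos n l).le
  · have h2 : (sideLength (c n) (k n) l : ℝ) ≤ c n l / (k n : ℝ) ^ (1 / (d : ℝ)) :=
      Int.floor_le _
    rw [div_le_iff₀ (hcpos n l), add_mul, inv_mul_cancel₀ (hcpos n l).ne', ← div_eq_inv_mul]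
    linarith

lemma prod_le_prod_sideLength_mul {d : ℕ} (hd : 1 ≤ d) {c : Fin d → ℝ} (hc : ∀ l, 0 < c l) {k : ℕ}
    (hk : 0 < k) : ∏ l, c l ≤ (∏ l, ((sideLength c k l : ℝ) + 1)) * k := by
  have hk' : (0 : ℝ) < k := by exact_mod_cast hk
  have hr : (0 : ℝ) < (k : ℝ) ^ (1 / (d : ℝ)) := Real.rpow_pos_of_pos hk' _
  have h1 : (k : ℝ) = ∏ _l : Fin d, (k : ℝ) ^ (1 / (d : ℝ)) := by
    rw [Finset.prod_const, Finset.card_univ, Fintype.card_fin, one_div,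
      Real.rpow_inv_natCast_pow hk'.le (by omega)]
  conv_rhs => rw [h1]
  rw [← Finset.prod_mul_distrib]
  refine Finset.prod_le_prod (fun l _ => (hc l).le) fun l _ => ?_
  rw [← div_le_iff₀ hr]
  exact (div_lt_sideLength_add_one c k l).le

/-- The gaps between blocks are negligible with respect to the side lengths. -/
lemma tendsto_gap_div {d : ℕ} {c : ℕ → Fin d → ℝ} (hcpos : ∀ n l, 0 < c n l) {k : ℕ → ℕ}
    (hk : Tendsto k atTop atTop) {γ : ℕ → Fin d → ℝ} {l : Fin d}
    (hkγ : Tendsto (fun n => (k n : ℝ) ^ (1 / (d : ℝ)) * γ n l / c n l) atTop (𝓝 0)) :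
    Tendsto (fun n => (⌊|γ n l|⌋ : ℝ) / ((sideLength (c n) (k n) l : ℝ) + 1)) atTop (𝓝 0) := by
  have h1 := hkγ.abs
  rw [abs_zero] at h1
  refine squeeze_zero' (Eventually.of_forall fun n => ?_) ?_ h1
  · have : (0 : ℝ) ≤ sideLength (c n) (k n) l := by exact_mod_cast sideLength_nonneg (hcpos n) _ _
    exact div_nonneg (by exact_mod_cast Int.floor_nonneg.2 (abs_nonneg _)) (by linarith)
  · filter_upwards [hk.eventually_gt_atTop 0] with n hn
    have hr : (0 : ℝ) < (k n : ℝ) ^ (1 / (d : ℝ)) :=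
      Real.rpow_pos_of_pos (by exact_mod_cast hn) _
    have h2 := div_lt_sideLength_add_one (c n) (k n) l
    have h3 : 0 < c n l / (k n : ℝ) ^ (1 / (d : ℝ)) := div_pos (hcpos n l) hr
    refine (div_le_div₀ (abs_nonneg _) (Int.floor_le _) h3 h2.le).trans_eq ?_
    rw [abs_div, abs_mul, abs_of_pos hr, abs_of_pos (hcpos n l)]
    field_simp

/-- The asymptotics of the tiling of `D_n` by blocks with side lengths `s = t + 1 - ⌊|γ|⌋`, placed
at mesh `t + 1`: the number of blocks is `O(k_n)`, the blocks fill `D_n`, the gaps are negligible,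
and a single block is small. -/
lemma tiling_asymptotics {d : ℕ} (hd : 1 ≤ d) {D : ℕ → Set (Fin d → ℤ)} {c : ℕ → Fin d → ℝ}
    (hD : GeometricAssumption D c) {k : ℕ → ℕ} (hk : Tendsto k atTop atTop) {α : ℕ → ℝ}
    (hkα : Tendsto (fun n => (k n : ℝ) * α n) atTop (𝓝 0)) {γ : ℕ → Fin d → ℝ}
    (hkγ : ∀ l, Tendsto (fun n => (k n : ℝ) ^ (1 / (d : ℝ)) * γ n l / c n l) atTop (𝓝 0))
    {t s : ℕ → Fin d → ℤ} (ht : ∀ n, t n = sideLength (c n) (k n))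
    (hs : ∀ n l, s n l = t n l + 1 - ⌊|γ n l|⌋) {m : ℕ → ℕ}
    (hm : ∀ n, m n = (innerCells (t n + 1) (D n)).ncard) :
    (∀ n, (D n).Finite) ∧ (∀ᶠ n in atTop, 0 < (D n).ncard) ∧ (∀ᶠ n in atTop, ∀ l, 1 ≤ s n l) ∧
    (∀ n, (m n : ℝ) * (∏ l, ((t n l : ℝ) + 1)) ≤ (D n).ncard) ∧
    Tendsto (fun n => (m n : ℝ) * α n) atTop (𝓝 0) ∧
    Tendsto (fun n => m n * (∏ l, (s n l : ℝ)) / (D n).ncard) atTop (𝓝 1) ∧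
    Tendsto (fun n => (∏ l, ((s n l : ℝ) + 2 * ⌊|γ n l|⌋)) / ∏ l, (s n l : ℝ)) atTop (𝓝 1) ∧
    Tendsto (fun n => (∏ l, ((t n l : ℝ) + 1)) / (D n).ncard) atTop (𝓝 0) := by
  obtain ⟨-, -, -, -, -, hcpos, hc, -⟩ := id hD
  have ht0 : ∀ n l, 0 ≤ t n l := fun n l => ht n ▸ sideLength_nonneg (hcpos n) _ _
  have ht0' : ∀ n l, (0 : ℝ) < (t n l : ℝ) + 1 := fun n l => by
    have : (0 : ℝ) ≤ t n l := by exact_mod_cast ht0 n l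
    linarith
  have hτ : ∀ n l, 0 < (t n + 1) l := fun n l => by simp; linarith [ht0 n l]
  have hτc : ∀ l, Tendsto (fun n => ((t n l : ℝ) + 1) / c n l) atTop (𝓝 0) := fun l => by
    simpa only [ht] using tendsto_sideLength_div hd hcpos hc hk l
  have hgτ : ∀ l, Tendsto (fun n => (⌊|γ n l|⌋ : ℝ) / ((t n l : ℝ) + 1)) atTop (𝓝 0) :=
    fun l => by simpa only [ht] using tendsto_gap_div hcpos hk (hkγ l)
  obtain ⟨hfin, ⟨a, ha0, ha⟩, hlow, hfill⟩ := hD.asymptotics hd (τ := fun n => t n + 1) hτ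
    (by simpa using hτc)
  simp only [Pi.add_apply, Pi.one_apply, Int.cast_add, Int.cast_one, ← hm] at hfill
  have hprod : ∀ n, 0 < ∏ l, c n l := fun n => Finset.prod_pos fun l _ => hcpos n l
  have hV : ∀ n, (0 : ℝ) < ∏ l, ((t n l : ℝ) + 1) := fun n => Finset.prod_pos fun l _ => ht0' n l
  have hmV : ∀ n, (m n : ℝ) * (∏ l, ((t n l : ℝ) + 1)) ≤ (D n).ncard := fun n => by
    have := ncard_innerCells_mul_le (hτ n) (hfin n)
    simpa [← hm] using this
  have hs' : ∀ n l, (s n l : ℝ) = t n l + 1 - ⌊|γ n l|⌋ := fun n l => by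
    rw [hs]; push_cast; ring
  have hs1 : ∀ᶠ n in atTop, ∀ l, 1 ≤ s n l := by
    refine eventually_all.2 fun l => ?_
    filter_upwards [(hgτ l).eventually_lt_const zero_lt_one] with n hn
    rw [div_lt_one (ht0' n l)] at hn
    have : ⌊|γ n l|⌋ < t n l + 1 := by exact_mod_cast hn
    linarith [hs n l]
  have hsτ : ∀ l, Tendsto (fun n => (s n l : ℝ) / ((t n l : ℝ) + 1)) atTop (𝓝 1) := fun l => by
    have := (hgτ l).const_sub 1
    rw [sub_zero] at this
    refine this.congr fun n => ?_
    rw [hs', sub_div, div_self (ht0' n l).ne']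
  refine ⟨hfin, ?_, hs1, hmV, ?_, ?_, ?_, ?_⟩
  · filter_upwards [hlow] with n hn
    have : (0 : ℝ) < (D n).ncard := by linarith [hprod n]
    exact_mod_cast this
  · have h1 : Tendsto (fun n => a * |(k n : ℝ) * α n|) atTop (𝓝 0) := by
      simpa using hkα.abs.const_mul a
    refine squeeze_zero_norm' ?_ h1
    filter_upwards [ha, hk.eventually_gt_atTop 0] with n hn hkn
    have h2 := prod_le_prod_sideLength_mul hd (hcpos n) hkn
    rw [← ht] at h2
    have h3 : (m n : ℝ) ≤ a * k n := by
      refine le_of_mul_le_mul_right ?_ (hV n)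
      have := mul_le_mul_of_nonneg_left h2 ha0.le
      linarith [hmV n]
    rw [Real.norm_eq_abs, abs_mul, abs_mul, Nat.abs_cast, Nat.abs_cast, ← mul_assoc]
    exact mul_le_mul_of_nonneg_right h3 (abs_nonneg _)
  · have h1 : Tendsto (fun n => ∏ l, ((s n l : ℝ) / ((t n l : ℝ) + 1))) atTop (𝓝 1) := by
      simpa using tendsto_finsetProd Finset.univ fun l _ => hsτ l
    have h2 := hfill.mul h1
    rw [mul_one] at h2
    refine h2.congr fun n => ?_
    rw [Finset.prod_div_distrib]
    field_simp [(hV n).ne']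
  · have h1 : ∀ l, Tendsto (fun n => ((s n l : ℝ) + 2 * ⌊|γ n l|⌋) / s n l) atTop (𝓝 1) := by
      intro l
      have h2 := (((hgτ l).div (hsτ l) one_ne_zero).const_mul 2).const_add 1
      simp only [zero_div, mul_zero, add_zero] at h2
      refine h2.congr' ?_
      filter_upwards [hs1] with n hn
      have h3 : (0 : ℝ) < s n l := by exact_mod_cast hn l
      have := (ht0' n l).ne'
      simp only [Pi.div_apply]
      field_simp
    simp only [← Finset.prod_div_distrib]
    simpa using tendsto_finsetProd Finset.univ fun l _ => h1 l
  · have h1 : Tendsto (fun n => 4 * ∏ l, (((t n l : ℝ) + 1) / c n l)) atTop (𝓝 0) := by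
      have := (tendsto_finsetProd Finset.univ fun l _ => hτc l).const_mul 4
      simpa [Nat.one_le_iff_ne_zero.1 hd] using this
    refine squeeze_zero' (Eventually.of_forall fun n =>
      div_nonneg (hV n).le (Nat.cast_nonneg _)) ?_ h1
    filter_upwards [hlow] with n hn
    have hN : (0 : ℝ) < (D n).ncard := by linarith [hprod n]
    rw [Finset.prod_div_distrib, div_le_iff₀ hN, mul_comm 4, mul_assoc, div_mul_eq_mul_div,
      le_div_iff₀ (hprod n)]
    exact mul_le_mul_of_nonneg_left hn (hV n).le

/-- A bounded expected number of exceedances makes all error terms of the lower bound small. -/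
lemma error_le {m b V u N M j w : ℝ} (hm : 0 ≤ m) (hb : 0 < b) (hbV : b ≤ V) (hN : 0 < N)
    (hu : 0 ≤ u) (hw : 0 ≤ w) (hmV : m * V ≤ N) (hNu : N * u ≤ M) (hbj : b ≤ j) :
    (N - m * b) * u + m * (b * u) ^ 2 + m * ((j - b) * u + (b * u) * ((w * V) * u)) ≤
      (1 - m * b / N) * M + (1 + w) * (M * M * (V / N)) + M * (j / b - 1) := by
  have hV : 0 < V := hb.trans_le hbV
  have hM : 0 ≤ M := (mul_nonneg hN.le hu).trans hNu
  have hmb : m * b ≤ N := (mul_le_mul_of_nonneg_left hbV hm).trans hmV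
  have hmbu : m * b * u ≤ M := (mul_le_mul_of_nonneg_right hmb hu).trans hNu
  have hmbu0 : 0 ≤ m * b * u := mul_nonneg (mul_nonneg hm hb.le) hu
  have hVu : V * u ≤ M * (V / N) := by
    have := mul_le_mul_of_nonneg_right hNu (div_pos hV hN).le
    calc V * u = N * u * (V / N) := by field_simp
      _ ≤ _ := this
  have hbu : b * u ≤ M * (V / N) := (mul_le_mul_of_nonneg_right hbV hu).trans hVu
  have h1 : (N - m * b) * u ≤ (1 - m * b / N) * M := by
    have h : 0 ≤ 1 - m * b / N := sub_nonneg.2 ((div_le_one hN).2 hmb)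
    calc (N - m * b) * u = (1 - m * b / N) * (N * u) := by field_simp
      _ ≤ _ := mul_le_mul_of_nonneg_left hNu h
  have h2 : m * (b * u) ^ 2 ≤ M * (M * (V / N)) := by
    calc m * (b * u) ^ 2 = (m * b * u) * (b * u) := by ring
      _ ≤ _ := mul_le_mul hmbu hbu (mul_nonneg hb.le hu) hM
  have h3 : m * ((j - b) * u) ≤ M * (j / b - 1) := by
    have h : 0 ≤ j / b - 1 := sub_nonneg.2 ((one_le_div hb).2 hbj)
    calc m * ((j - b) * u) = (m * b * u) * (j / b - 1) := by field_simp
      _ ≤ _ := mul_le_mul_of_nonneg_right hmbu h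
  have h4 : m * ((b * u) * ((w * V) * u)) ≤ w * (M * (M * (V / N))) := by
    calc m * ((b * u) * ((w * V) * u)) = w * ((m * b * u) * (V * u)) := by ring
      _ ≤ _ := mul_le_mul_of_nonneg_left
        (mul_le_mul hmbu hVu (mul_nonneg hV.le hu) hM) hw
  linarith

end SpatialMax

theorem lemma3p3 {d : ℕ} (hd : 1 ≤ d)
    {Ω : Type*} [MeasurableSpace Ω] (P : Measure Ω) [IsProbabilityMeasure P]
    (D : ℕ → Set (Fin d → ℤ)) (c : ℕ → Fin d → ℝ)
    (hD : SpatialMax.GeometricAssumption D c)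
    (κ : ℝ) (hκ : 0 < κ)
    (hK : ∀ᶠ n in atTop, D n ⊆ SpatialMax.surroundingBox κ (c n))
    (ξ : (Fin d → ℤ) → Ω → ℝ) (hξ : SpatialMax.IsStationaryField P ξ)
    (x : ℕ → ℝ) (γ : ℕ → Fin d → ℝ) (α : ℕ → ℝ)
    (hmix : SpatialMax.MixingCondition P ξ x
      (fun n => SpatialMax.surroundingBox κ (c n)) c γ α)
    (k : ℕ → ℕ) (hk : Tendsto k atTop atTop)
    (hkα : Tendsto (fun n => (k n : ℝ) * α n) atTop (𝓝 0))
    (hkγ : ∀ l, Tendsto (fun n => (k n : ℝ) ^ (1 / (d : ℝ)) * γ n l / c n l) atTop (𝓝 0))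
    (le : (Fin d → ℤ) → (Fin d → ℤ) → Prop) (hle : SpatialMax.IsInvariantTotalOrder le) :
    (∃ ε : ℕ → ℝ, Tendsto ε atTop (𝓝 0) ∧ ∀ n,
      P.real {ω | SpatialMax.fieldMax ξ (D n) ω ≤ (x n : EReal)} ≤
        Real.exp (-((D n).ncard * P.real {ω |
          SpatialMax.fieldMax ξ
            (SpatialMax.laterPoints le (SpatialMax.sideLength (c n) (k n)) 0) ω ≤ (x n : EReal) ∧
          x n < ξ 0 ω})) + ε n) ∧
    (limsup (fun n => ((D n).ncard : ℝ≥0∞) * P {ω | x n < ξ 0 ω}) atTop < ⊤ →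
      ∃ ε : ℕ → ℝ, Tendsto ε atTop (𝓝 0) ∧ ∀ n,
      P.real {ω | SpatialMax.fieldMax ξ (D n) ω ≤ (x n : EReal)} =
        Real.exp (-((D n).ncard * P.real {ω |
          SpatialMax.fieldMax ξ
            (SpatialMax.laterPoints le (SpatialMax.sideLength (c n) (k n)) 0) ω ≤ (x n : EReal) ∧
          x n < ξ 0 ω})) + ε n) := by
  classical
  open SpatialMax in
  obtain ⟨-, -, -, -, -, hcpos, hc, -⟩ := id hD
  have hmix' : ∀ n, ∀ A B : Set (Fin d → ℤ), A ⊆ surroundingBox κ (c n) →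
      B ⊆ surroundingBox κ (c n) → Separated (γ n) A B → (IsBox A ∨ IsBox B) →
      |P.real (underLevel ξ (x n) (A ∪ B)) -
        P.real (underLevel ξ (x n) A) * P.real (underLevel ξ (x n) B)| ≤ α n := by
    have h := hmix.mixing
    simp only [fieldMax_le_iff] at h
    exact h
  simp only [fieldMax_le_iff]
  change (∃ ε : ℕ → ℝ, Tendsto ε atTop (𝓝 0) ∧ ∀ n, P.real (underLevel ξ (x n) (D n)) ≤
      Real.exp (-((D n).ncard *
        P.real (lastExceedance ξ (x n) le (sideLength (c n) (k n)) 0))) + ε n) ∧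
    (_ → ∃ ε : ℕ → ℝ, Tendsto ε atTop (𝓝 0) ∧ ∀ n, P.real (underLevel ξ (x n) (D n)) =
      Real.exp (-((D n).ncard *
        P.real (lastExceedance ξ (x n) le (sideLength (c n) (k n)) 0))) + ε n)
  set t : ℕ → Fin d → ℤ := fun n => sideLength (c n) (k n) with ht
  set s : ℕ → Fin d → ℤ := fun n l => t n l + 1 - ⌊|γ n l|⌋ with hs
  set m : ℕ → ℕ := fun n => (innerCells (t n + 1) (D n)).ncard with hm
  obtain ⟨hfin, hN0, hs1, hmV, hmα, hr, hj, hVN⟩ := tiling_asymptotics hd hD hk hkα hkγ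
    (t := t) (s := s) (m := m) (fun _ => rfl) (fun _ _ => rfl) (fun _ => rfl)
  have ht0 : ∀ n l, 0 ≤ t n l := fun n l => sideLength_nonneg (hcpos n) _ _
  have hIfin : ∀ n, (innerCells (t n + 1) (D n)).Finite := fun n =>
    finite_innerCells (fun l => by simp; linarith [ht0 n l]) (hfin n)
  have hcard : ∀ n, (hIfin n).toFinset.card = m n := fun n =>
    (Set.ncard_eq_toFinset_card _ (hIfin n)).symm
  have hbV : ∀ᶠ n in atTop, (∏ l, (s n l : ℝ)) ≤ ∏ l, ((t n l : ℝ) + 1) := by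
    filter_upwards [hs1] with n hn
    refine Finset.prod_le_prod (fun l _ => by exact_mod_cast (by linarith [hn l])) fun l _ => ?_
    have : 0 ≤ ⌊|γ n l|⌋ := Int.floor_nonneg.2 (abs_nonneg _)
    exact_mod_cast (by simp only [hs]; linarith : s n l ≤ t n l + 1)
  have hq0 : ∀ n, 0 ≤ P.real (lastExceedance ξ (x n) le (t n) 0) := fun n => measureReal_nonneg
  -- The common upper bound, with an explicit error term.
  have hupper : ∀ᶠ n in atTop, P.real (underLevel ξ (x n) (D n)) -
      Real.exp (-((D n).ncard * P.real (lastExceedance ξ (x n) le (t n) 0))) ≤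
      (1 - m n * (∏ l, (s n l : ℝ)) / (D n).ncard) / (m n * (∏ l, (s n l : ℝ)) / (D n).ncard) +
        m n * α n := by
    filter_upwards [hK, hN0, hs1, hbV, hr.eventually_const_lt zero_lt_one] with n hKn hNn hsn hbn hrn
    have h1 := hξ.measureReal_underLevel_le_exp hle (hmix' n) (ht0 n) (s := s n) (fun _ => rfl) hsn
      hKn (I := (hIfin n).toFinset) (by simp)
    rw [hcard] at h1
    have hN : (0 : ℝ) < (D n).ncard := by exact_mod_cast hNn
    have h2 := exp_neg_mul_le (y := (D n).ncard * P.real (lastExceedance ξ (x n) le (t n) 0)) hrn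
      ((div_le_one hN).2 ((mul_le_mul_of_nonneg_left hbn (Nat.cast_nonneg _)).trans (hmV n)))
    rw [show m n * (∏ l, (s n l : ℝ)) / (D n).ncard *
      ((D n).ncard * P.real (lastExceedance ξ (x n) le (t n) 0)) = m n * ((∏ l, (s n l : ℝ)) *
        P.real (lastExceedance ξ (x n) le (t n) 0)) by field_simp] at h2
    linarith
  have hupper0 : Tendsto (fun n => (1 - m n * (∏ l, (s n l : ℝ)) / (D n).ncard) /
      (m n * (∏ l, (s n l : ℝ)) / (D n).ncard) + m n * α n) atTop (𝓝 0) := by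
    simpa using ((hr.const_sub 1).div hr one_ne_zero).add hmα
  refine ⟨⟨fun n => max 0 (P.real (underLevel ξ (x n) (D n)) -
    Real.exp (-((D n).ncard * P.real (lastExceedance ξ (x n) le (t n) 0)))), ?_, fun n => ?_⟩, ?_⟩
  · refine squeeze_zero' (Eventually.of_forall fun n => le_max_left _ _)
      (hupper.mono fun n hn => max_le_max_left 0 hn) ?_
    simpa using hupper0.max (tendsto_const_nhds (x := (0 : ℝ))) |>.congr fun n => max_comm _ _
  · linarith [le_max_right 0 (P.real (underLevel ξ (x n) (D n)) -
      Real.exp (-((D n).ncard * P.real (lastExceedance ξ (x n) le (t n) 0))))]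
  intro hlim
  refine ⟨fun n => P.real (underLevel ξ (x n) (D n)) -
    Real.exp (-((D n).ncard * P.real (lastExceedance ξ (x n) le (t n) 0))), ?_, fun n => by ring⟩
  obtain ⟨M, hM⟩ : ∃ M : ℝ, ∀ᶠ n in atTop, (D n).ncard * P.real {ω | x n < ξ 0 ω} ≤ M := by
    obtain ⟨y, hy1, hy2⟩ := exists_between hlim
    refine ⟨y.toReal, (eventually_lt_of_limsup_lt hy1).mono fun n hn => ?_⟩
    have := ENNReal.toReal_mono hy2.ne hn.le
    simpa [measureReal_def] using this
  have hKbox : ∀ᶠ n in atTop, ∀ v : Fin d → ℤ, (∀ l, |v l| ≤ 2 * (t n l + 1)) →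
      v ∈ surroundingBox κ (c n) := by
    filter_upwards [eventually_all.2 fun l => (tendsto_sideLength_div hd hcpos hc hk l
      ).eventually_le_const (half_pos hκ)] with n hn v hv l
    have h1 := (div_le_iff₀ (hcpos n l)).1 (hn l)
    have h2 : |(v l : ℝ)| ≤ 2 * ((t n l : ℝ) + 1) := by exact_mod_cast hv l
    linarith
  have hlower : ∀ᶠ n in atTop, -((1 - m n * (∏ l, (s n l : ℝ)) / (D n).ncard) * M +
      (1 + 3 ^ d) * (M * M * ((∏ l, ((t n l : ℝ) + 1)) / (D n).ncard)) +
      M * ((∏ l, ((s n l : ℝ) + 2 * ⌊|γ n l|⌋)) / (∏ l, (s n l : ℝ)) - 1) + 2 * (m n * α n)) ≤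
      P.real (underLevel ξ (x n) (D n)) -
        Real.exp (-((D n).ncard * P.real (lastExceedance ξ (x n) le (t n) 0))) := by
    filter_upwards [hK, hN0, hs1, hbV, hKbox, hM] with n hKn hNn hsn hbn hKb hMn
    have h1 := hξ.exp_le_measureReal_underLevel_add hle (hmix' n) (ht0 n) (s := s n)
      (fun _ => rfl) hsn hKn (I := (hIfin n).toFinset) (by simp) (hfin n) hKb
    rw [hcard] at h1
    have hN : (0 : ℝ) < (D n).ncard := by exact_mod_cast hNn
    have hs0 : ∀ l, (0 : ℝ) < s n l := fun l => by exact_mod_cast hsn l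
    have h2 := error_le (Nat.cast_nonneg (m n)) (Finset.prod_pos fun l _ => hs0 l) hbn hN
      (measureReal_nonneg (μ := P) (s := {ω | x n < ξ 0 ω})) (w := 3 ^ d) (by positivity) (hmV n)
      hMn (j := ∏ l, ((s n l : ℝ) + 2 * ⌊|γ n l|⌋))
      (Finset.prod_le_prod (fun l _ => (hs0 l).le) fun l _ => by
        have : (0 : ℝ) ≤ ⌊|γ n l|⌋ := by exact_mod_cast Int.floor_nonneg.2 (abs_nonneg _)
        linarith)
    have h3 : Real.exp (-((D n).ncard * P.real (lastExceedance ξ (x n) le (t n) 0))) ≤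
        Real.exp (-(m n * ((∏ l, (s n l : ℝ)) *
          P.real (lastExceedance ξ (x n) le (t n) 0)))) := by
      refine Real.exp_le_exp.2 (neg_le_neg ?_)
      rw [← mul_assoc]
      exact mul_le_mul_of_nonneg_right
        ((mul_le_mul_of_nonneg_left hbn (Nat.cast_nonneg _)).trans (hmV n)) (hq0 n)
    linarith
  have hlower0 : Tendsto (fun n => -((1 - m n * (∏ l, (s n l : ℝ)) / (D n).ncard) * M +
      (1 + 3 ^ d) * (M * M * ((∏ l, ((t n l : ℝ) + 1)) / (D n).ncard)) +
      M * ((∏ l, ((s n l : ℝ) + 2 * ⌊|γ n l|⌋)) / (∏ l, (s n l : ℝ)) - 1) + 2 * (m n * α n)))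
      atTop (𝓝 0) := by
    simpa using (((((hr.const_sub 1).mul_const M).add
      ((hVN.const_mul (M * M)).const_mul (1 + 3 ^ d))).add
      ((hj.sub_const 1).const_mul M)).add (hmα.const_mul 2)).neg
  exact tendsto_of_tendsto_of_tendsto_of_le_of_le' hlower0 hupper0 hlower hupper
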